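/- Let $m,n\ge 2$ be integers, let $X=\{1,\dots,m\}\times\{1,\dots,n\}$, and let $\mathcal P=\{C_1,\dots,C_m\}$ be the partition of $X$ into the blocks $C_i=\{i\}\times\{1,\dots,n\}$. For $k\ge 0$ let $\mathcal T_k$ be the monoid of all maps from $\{1,\dots,k\}$ to itself, $\mathcal S_k$ the symmetric group of its permutations, and $\mathcal E_k$ the submonoid of $\mathcal T_k$ generated by the idempotents of $\mathcal T_k$. Let $\mathcal T(X,\mathcal P)$ be the monoid of all maps $f:X\to X$ such that for every $i$ there is $j$ with $f(C_i)\subseteq C_j$, and let $S$ be the submonoid of $\mathcal T(X,\mathcal P)$ generated by its idempotents. An *idempotent generating set* of a monoid is a set of idempotents that generates it as a monoid; it is called *minimal* if no idempotent generating set has smaller cardinality. For $i\ne j$ let $e_{ij}$ be the map that sends $j$ to $i$ and fixes all other points. For $f_1,\dots,f_m\in\mathcal T_n$ and $g\in\mathcal T_m$ let $[f_1,\dots,f_m;g]$ be the map $(i,x)\mapsto(g(i),f_i(x))$ on $X$. For $i\ne j$ in $\{1,\dots,m\}$ and $f\in\mathcal S_n$ put $e_{ij;f}=[1,\dots,1,f,1,\dots,1;e_{ij}]$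 with $f$ in position $j$, and for $U\subseteq\mathcal T_n$ put $U^{(i)}=\{[1,\dots,1,g,1,\dots,1;1] : g\in U\}$ with $g$ in position $i$. Let $w_k$ be the number of strongly connected tournaments on the vertex set $\{1,\dots,k\}$, and let $w_{kd}$ be the number of strongly connected loopless digraphs on $\{1,\dots,k\}$ in which any two distinct vertices are joined by an edge in at least one direction and exactly $d$ pairs of vertices are joined by edges in both directions. Put $\sigma_2=1$ and $\sigma_k=w_k$ for $k\neq 2$. Then the following hold. (i) Every idempotent generating set of $S$ contains a minimal idempotent generating set of $S$. Consequently, an idempotent generating set of $S$ is minimal if and only if no proper subset of it is an idempotent generating set of $S$. (ii) Every minimal idempotent generating set of $S$ has the form $$U_1^{(1)}\cup\cdots\cup U_m^{(m)}\cup\bigcup_{(i,j)\in\Phi_V}\{e_{ij;f}: f\in\mathcal S_n\}\cup\bigcup_{(i,j)\in\Xi_V}\Big(\{e_{ij;f}: f\in A_{ij}\}\cup\{e_{ji;f^{-1}}: f\in B_{ij}\}\Big),$$ where $U_1,\dots,U_m$ are minimal idempotent generating sets of $\mathcal E_n$; $V$ is a set of idempotents of $\mathcal T_m$ of rank $m-1$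 that generates $\mathcal T_m\setminus\mathcal S_m$ as a semigroup; $\Xi_V=\{(i,j): i<j,\ e_{ij}\in V,\ e_{ji}\in V\}$ and $\Phi_V=\{(i,j): i\neq j,\ e_{ij}\in V,\ e_{ji}\notin V\}$; and, for each $(i,j)\in\Xi_V$, $A_{ij}$ and $B_{ij}$ are disjoint non-empty sets with $A_{ij}\cup B_{ij}=\mathcal S_n$. (iii) The number of minimal idempotent generating sets of $S$ is $$\sigma_n^m\sum_{k=0}^{\binom m2} w_{mk}\,(2^{n!}-2)^k.$$ -/

import Mathlib

namespace UniformPartition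

/-! ### Idempotent generating sets

Transformations of `X` are elements of `Function.End X`, with `(f * g) x = f (g x)`.  If maps are
written on the right instead, the product of a list of transformations is the product of the
reversed list here, so idempotents and generated submonoids (subsemigroups) are the same sets for
both conventions. -/

section Generation

variable {M : Type*} [Monoid M]

/-- The set `E(T)` of idempotents of a submonoid `T`. -/
def idempotents (T : Submonoid M) : Set M := {x | x ∈ T ∧ IsIdempotentElem x}

/-- The submonoid `⟨E(T)⟩` generated by the idempotents of `T`. -/
def idempotentGenerated (T : Submonoid M) : Submonoid M := Submonoid.closure (idempotents T)

/-- `U` is a set of idempotents of `S` that generates `S` as a monoid. -/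
def IsIdempotentGeneratingSet (S : Submonoid M) (U : Set M) : Prop :=
  U ⊆ idempotents S ∧ Submonoid.closure U = S

/-- `U` is an idempotent generating set of `S` of smallest possible cardinality. -/
def IsMinimalIdempotentGeneratingSet (S : Submonoid M) (U : Set M) : Prop :=
  IsIdempotentGeneratingSet S U ∧ ∀ U', IsIdempotentGeneratingSet S U' → U.encard ≤ U'.encard

end Generation

/-! ### Transformations of `{1, …, k}` -/

/-- `𝓔_k`, the monoid generated by all idempotent transformations of a `k`-element set. -/
def E (k : ℕ) : Submonoid (Function.End (Fin k)) := idempotentGenerated ⊤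

/-- `E(𝓓_k)`: the idempotent transformations of rank `k - 1` (none if `k ≤ 1`). -/
def defectOneIdempotents (k : ℕ) : Set (Function.End (Fin k)) :=
  {f | IsIdempotentElem f ∧ (Set.range (f : Fin k → Fin k)).ncard + 1 = k}

/-- `𝓣_k ∖ 𝓢_k`: the non-invertible transformations. -/
def singular (k : ℕ) : Set (Function.End (Fin k)) :=
  {f | ¬ Function.Bijective (f : Fin k → Fin k)}

/-- `e_{ij}`: maps `j` to `i` and fixes everything else. -/
def e {k : ℕ} (i j : Fin k) : Function.End (Fin k) :=
  fun x => if x = j then i else x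

/-! ### Transformations of `{1, …, m} × {1, …, n}` preserving the blocks `C_i = {i} × {1, …, n}` -/

/-- The block `C_i`. -/
def block {m : ℕ} (n : ℕ) (i : Fin m) : Set (Fin m × Fin n) := {x | x.1 = i}

/-- `𝓣(X,𝓟)`: the transformations mapping each block into some block. -/
def TXP (m n : ℕ) : Submonoid (Function.End (Fin m × Fin n)) where
  carrier := {f | ∀ i, ∃ j, Set.MapsTo f (block n i) (block n j)}
  one_mem' := fun i => ⟨i, fun _ hx => hx⟩
  mul_mem' := by
    intro f g hf hg i
    obtain ⟨j, hj⟩ := hg i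
    obtain ⟨k, hk⟩ := hf j
    exact ⟨k, fun x hx => hk (hj hx)⟩

/-- `S = 𝓔(X,𝓟)`: the submonoid generated by the idempotents of `𝓣(X,𝓟)`. -/
def EXP (m n : ℕ) : Submonoid (Function.End (Fin m × Fin n)) := idempotentGenerated (TXP m n)

/-- `[f_1, …, f_m; g]`: the transformation sending `(i, x)` to `(g i, f_i x)`. -/
def mk {m n : ℕ} (f : Fin m → Function.End (Fin n)) (g : Function.End (Fin m)) :
    Function.End (Fin m × Fin n) :=
  fun x => (g x.1, f x.1 x.2)

/-- `e_{ij;f} = [1, …, 1, f, 1, …, 1; e_{ij}]` with the permutation `f` in position `j`. -/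
def eTwist {m n : ℕ} (i j : Fin m) (f : Equiv.Perm (Fin n)) : Function.End (Fin m × Fin n) :=
  mk (fun k x => if k = j then f x else x) (e i j)

/-- `g^{(i)} = [1, …, 1, g, 1, …, 1; 1]` with `g` in position `i`. -/
def inBlock {m n : ℕ} (i : Fin m) (g : Function.End (Fin n)) : Function.End (Fin m × Fin n) :=
  mk (fun k x => if k = i then g x else x) 1

/-- `Ξ_V`: the pairs `i < j` such that both `e_{ij}` and `e_{ji}` belong to `V`. -/
def Xi {m : ℕ} (V : Set (Function.End (Fin m))) : Set (Fin m × Fin m) :=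
  {p | p.1 < p.2 ∧ e p.1 p.2 ∈ V ∧ e p.2 p.1 ∈ V}

/-- `Φ_V`: the pairs `i ≠ j` such that `e_{ij}` belongs to `V` but `e_{ji}` does not. -/
def Phi {m : ℕ} (V : Set (Function.End (Fin m))) : Set (Fin m × Fin m) :=
  {p | p.1 ≠ p.2 ∧ e p.1 p.2 ∈ V ∧ e p.2 p.1 ∉ V}

/-- The set
`⋃_{(i,j) ∈ Φ_V} {e_{ij;f} | f ∈ 𝓢_n}
  ∪ ⋃_{(i,j) ∈ Ξ_V} ({e_{ij;f} | f ∈ A_{ij}} ∪ {e_{ji;f⁻¹} | f ∈ B_{ij}})`. -/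
def twistSet {m n : ℕ} (V : Set (Function.End (Fin m)))
    (A B : Fin m × Fin m → Set (Equiv.Perm (Fin n))) : Set (Function.End (Fin m × Fin n)) :=
  (⋃ p ∈ Phi V, Set.range (fun f : Equiv.Perm (Fin n) => eTwist p.1 p.2 f)) ∪
    ⋃ p ∈ Xi V, ((fun f => eTwist p.1 p.2 f) '' A p ∪ (fun f => eTwist p.2 p.1 f⁻¹) '' B p)

/-- `W` has the form `U_1^{(1)} ∪ ⋯ ∪ U_m^{(m)} ∪ W'`, where the `U_i` are minimal idempotent
generating sets of `𝓔_n`, and `W'` is the set `twistSet V A B` for some `V ⊆ E(𝓓_m)` generating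
`𝓣_m ∖ 𝓢_m` as a semigroup and some ordered partitions of `𝓢_n` into two non-empty parts
`A_{ij}`, `B_{ij}`, one for each `(i,j) ∈ Ξ_V`. -/
def HasStandardForm {m n : ℕ} (W : Set (Function.End (Fin m × Fin n))) : Prop :=
  ∃ (U : Fin m → Set (Function.End (Fin n))) (V : Set (Function.End (Fin m)))
    (A B : Fin m × Fin m → Set (Equiv.Perm (Fin n))),
    (∀ i, IsMinimalIdempotentGeneratingSet (E n) (U i)) ∧
    V ⊆ defectOneIdempotents m ∧
    (Subsemigroup.closure V : Set (Function.End (Fin m))) = singular m ∧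
    (∀ p ∈ Xi V, (A p).Nonempty ∧ (B p).Nonempty ∧ Disjoint (A p) (B p) ∧
      A p ∪ B p = Set.univ) ∧
    W = (⋃ i, inBlock i '' U i) ∪ twistSet V A B

/-! ### Strongly connected tournaments and complete digraphs -/

/-- There is a directed path between any two vertices, in both directions. -/
def IsStronglyConnected {V : Type*} (G : Digraph V) : Prop :=
  ∀ u v, Relation.ReflTransGen G.Adj u v

/-- A loopless digraph in which any two distinct vertices are joined by at least one edge. -/
def IsCompleteDigraph {V : Type*} (G : Digraph V) : Prop :=
  (∀ v, ¬ G.Adj v v) ∧ ∀ u v, u ≠ v → G.Adj u v ∨ G.Adj v u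

/-- A loopless digraph in which any two distinct vertices are joined by exactly one edge. -/
def IsTournament {V : Type*} (G : Digraph V) : Prop :=
  (∀ v, ¬ G.Adj v v) ∧ ∀ u v, u ≠ v → Xor (G.Adj u v) (G.Adj v u)

/-- The number of double edges `u - v`, that is, of pairs `u < v` with `u → v` and `v → u`. -/
noncomputable def numDoubleEdges {k : ℕ} (G : Digraph (Fin k)) : ℕ :=
  {p : Fin k × Fin k | p.1 < p.2 ∧ G.Adj p.1 p.2 ∧ G.Adj p.2 p.1}.ncard

/-- `w_k`: the number of strongly connected tournaments on `{1, …, k}`. -/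
noncomputable def w (k : ℕ) : ℕ :=
  {G : Digraph (Fin k) | IsTournament G ∧ IsStronglyConnected G}.ncard

/-- `w_{kd}`: the number of strongly connected, complete digraphs on `{1, …, k}` with exactly
`d` double edges. -/
noncomputable def wDouble (k d : ℕ) : ℕ :=
  {G : Digraph (Fin k) |
    IsCompleteDigraph G ∧ IsStronglyConnected G ∧ numDoubleEdges G = d}.ncard

/-- `σ_2 = 1`, and `σ_k = w_k` for `k ≠ 2`. -/
noncomputable def sigma (k : ℕ) : ℕ := if k = 2 then 1 else w k

end UniformPartition

namespace UniformPartition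

/-! ### Transformation monoids -/

section Transformations

variable {α : Type*}

/-! Everything rests on a criterion: a set `U` of idempotents generates `EXP m n` exactly when (a)
for each `i` the elements `g` with `inBlock i g ∈ U` generate `E n`, (b) for all `i ≠ j` and `f`,
`U` contains `eTwist i j f` or `eTwist j i f⁻¹`, and (c) the digraph `Moves U` on the blocks is
strongly connected.

Sufficiency (`isIdempotentGeneratingSet_of_moves`): the two elements in (b) have the same kernel. If
only one is present, (c) allows the block missed by its image to be transported until the image is
that of the other, which is then a power of the result. Once all twists and all of `E n` inside each
block are available, any idempotent is peeled off block by block. Necessity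
(`mem_closure_inter_twists`, `closure_preimage_inBlock`): twists are so close to injective that
factorizations of them need only twists from `U`. The kernel of the rightmost factor then gives (b),
and following a point through the factors gives (c). A similar peeling gives (a).

To shrink `U`, one element of each pair in (b) is kept. As `n ≥ 2`, there are at least two
permutations, so whenever both directions between two blocks occur, both can be retained; no edge is
lost and (c) survives (`exists_choiceSet_subset`). For (a), the criterion is applied to blocks of
size one. There a choice can only keep one direction, but a complete strongly connected digraph on
at least three vertices contains a strongly connected tournament (`exists_isTournament_le`); two
vertices are the exception behind `sigma 2 = 1`.

The sets so obtained all have the same size, so minimality by size and by inclusion both mean being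
of this form (`minimal_iff_of_encard_eq`). For the count, a complete strongly connected digraph with
`d` double edges arises from `(2 ^ n! - 2) ^ d` choices: a proper non-empty set of permutations at
each double edge, no freedom elsewhere. -/

theorem end_mul_apply (f g : Function.End α) (x : α) : (f * g) x = f (g x) := rfl

theorem end_one_apply (x : α) : (1 : Function.End α) x = x := rfl

theorem end_ext {f g : Function.End α} (h : ∀ x, f x = g x) : f = g := funext h

theorem isIdempotentElem_end_iff {f : Function.End α} :
    IsIdempotentElem f ↔ ∀ x, f (f x) = f x :=
  ⟨fun h x => congrFun h x, fun h => funext h⟩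

/-- The transformation that agrees with `F` on `B` and fixes all other points. -/
noncomputable def restrictTo (B : Set α) (F : Function.End α) : Function.End α :=
  open Classical in fun x => if x ∈ B then F x else x

theorem restrictTo_of_mem {B : Set α} {F : Function.End α} {x : α} (h : x ∈ B) :
    restrictTo B F x = F x := if_pos h

theorem restrictTo_of_notMem {B : Set α} {F : Function.End α} {x : α} (h : x ∉ B) :
    restrictTo B F x = x := if_neg h

theorem restrictTo_isIdempotentElem (B : Set α) {F : Function.End α} (hF : IsIdempotentElem F) :
    IsIdempotentElem (restrictTo B F) := by
  rw [isIdempotentElem_end_iff] at *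
  intro x
  by_cases hx : x ∈ B
  · rw [restrictTo_of_mem hx]
    by_cases h : F x ∈ B
    · rw [restrictTo_of_mem h, hF]
    · rw [restrictTo_of_notMem h]
  · rw [restrictTo_of_notMem hx, restrictTo_of_notMem hx]

/-- Values of an idempotent are fixed points of it, so the second factor does not disturb what the
first has already moved. This allows idempotents to be peeled off one piece at a time. -/
theorem restrictTo_compl_mul_restrictTo (B : Set α) {F : Function.End α}
    (hF : IsIdempotentElem F) : restrictTo Bᶜ F * restrictTo B F = F := by
  rw [isIdempotentElem_end_iff] at hF
  refine end_ext fun x => ?_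
  rw [end_mul_apply]
  by_cases hx : x ∈ B
  · rw [restrictTo_of_mem hx]
    by_cases h : F x ∈ B
    · rw [restrictTo_of_notMem (by simpa using h)]
    · rw [restrictTo_of_mem (by simpa using h), hF]
  · rw [restrictTo_of_notMem hx, restrictTo_of_mem (by simpa using hx)]

/-- If `z` has the same kernel and image as the idempotent `t`, then `t` is a power of `z`. -/
theorem exists_pow_eq_of_mul_eq [Finite α] {z t : Function.End α} (h₁ : z * t = z)
    (h₂ : t * z = z) (hi : Set.InjOn z (Set.range t)) : ∃ N, z ^ N = t := by
  have : Finite (Function.End α) := inferInstanceAs (Finite (α → α))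
  obtain ⟨a, b, hab, hpow⟩ : ∃ a b : ℕ, a < b ∧ z ^ a = z ^ b := by
    obtain ⟨a, b, hne, h⟩ := Finite.exists_ne_map_eq_of_infinite (fun k : ℕ => z ^ k)
    rcases lt_or_gt_of_ne hne with h' | h'
    · exact ⟨a, b, h', h⟩
    · exact ⟨b, a, h', h.symm⟩
  have hmaps : ∀ k, ∀ x ∈ Set.range t, (z ^ k) x ∈ Set.range t := by
    intro k
    induction k with
    | zero => exact fun x hx => hx
    | succ k ih =>
      intro x hx
      rw [pow_succ', end_mul_apply]
      exact ⟨_, congrFun h₂ _⟩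
  have hinj : ∀ k, ∀ x ∈ Set.range t, ∀ y ∈ Set.range t, (z ^ k) x = (z ^ k) y → x = y := by
    intro k
    induction k with
    | zero => exact fun x _ y _ h => h
    | succ k ih =>
      intro x hx y hy hxy
      rw [pow_succ', end_mul_apply, end_mul_apply] at hxy
      exact ih x hx y hy (hi (hmaps k x hx) (hmaps k y hy) hxy)
  refine ⟨b - a, end_ext fun x => ?_⟩
  -- On the range of `t` all powers of `z` are injective, so `z ^ a` cancels from `z ^ a * z ^ (b -
  -- a) = z ^ a`.
  have hfix : ∀ y ∈ Set.range t, (z ^ (b - a)) y = y := by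
    intro y hy
    have hpow' : z ^ a * z ^ (b - a) = z ^ a := by
      rw [← pow_add, Nat.add_sub_cancel' hab.le, hpow]
    exact hinj a _ (hmaps _ y hy) _ hy (congrFun hpow' y)
  have hzt : z ^ (b - a) * t = z ^ (b - a) := by
    -- The exponent is positive, so a rightmost factor `z` is there to absorb `t`.
    obtain ⟨c, hc⟩ : ∃ c, b - a = c + 1 := ⟨b - a - 1, by omega⟩
    rw [hc, pow_succ, mul_assoc, h₁]
  rw [← hzt, end_mul_apply, hfix _ ⟨x, rfl⟩]

end Transformations

/-! ### Singular transformations are products of idempotents of defect one -/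

theorem e_apply_self {k : ℕ} (i j : Fin k) : e i j j = i := if_pos rfl

theorem e_apply_of_ne {k : ℕ} {i j x : Fin k} (h : x ≠ j) : e i j x = x := if_neg h

theorem e_isIdempotentElem {k : ℕ} {i j : Fin k} (h : i ≠ j) : IsIdempotentElem (e i j) := by
  rw [isIdempotentElem_end_iff]
  intro x
  by_cases hx : x = j
  · rw [hx, e_apply_self, e_apply_of_ne h]
  · rw [e_apply_of_ne hx, e_apply_of_ne hx]

theorem e_not_injective {k : ℕ} {i j : Fin k} (h : i ≠ j) : ¬ Function.Injective (e i j) :=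
  fun hi => h (hi ((e_apply_of_ne h).trans (e_apply_self i j).symm))

theorem e_ne_one {k : ℕ} {i j : Fin k} (h : i ≠ j) : e i j ≠ 1 :=
  fun h1 => e_not_injective h (h1 ▸ Function.injective_id)

theorem e_inj {k : ℕ} {i j i' j' : Fin k} (h : i ≠ j) (he : e i j = e i' j') :
    i = i' ∧ j = j' := by
  have hj : j = j' := by
    by_contra hne
    have := congrFun he j
    rw [e_apply_self, e_apply_of_ne hne] at this
    exact h this
  subst hj
  refine ⟨?_, rfl⟩
  have := congrFun he j
  rwa [e_apply_self, e_apply_self] at this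

/-- The set of all `e_{ij}` with `i ≠ j`. -/
def elementary (k : ℕ) : Set (Function.End (Fin k)) := {f | ∃ i j, i ≠ j ∧ e i j = f}

theorem e_mem_closure {k : ℕ} {i j : Fin k} (h : i ≠ j) :
    e i j ∈ Submonoid.closure (elementary k) := Submonoid.subset_closure ⟨i, j, h, rfl⟩

/-- Induction on the number of moved points: restricted to a single moved point `b`, the map is `e
(f b) b`. -/
theorem idempotent_mem_closure_elementary {k : ℕ} {f : Function.End (Fin k)}
    (hf : IsIdempotentElem f) : f ∈ Submonoid.closure (elementary k) := by
  obtain ⟨N, hN⟩ : ∃ N, {x | f x ≠ x}.ncard = N := ⟨_, rfl⟩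
  induction N generalizing f with
  | zero =>
    rw [Set.ncard_eq_zero] at hN
    have : f = 1 := end_ext fun x => by
      by_contra hx
      exact (Set.mem_empty_iff_false x).1 (hN ▸ hx)
    rw [this]
    exact one_mem _
  | succ N ih =>
    obtain ⟨b, hb⟩ : {x | f x ≠ x}.Nonempty := by
      rw [← Set.ncard_pos]
      omega
    rw [← restrictTo_compl_mul_restrictTo {b} hf]
    refine mul_mem (ih (restrictTo_isIdempotentElem _ hf) ?_) ?_
    · have : {x | restrictTo {b}ᶜ f x ≠ x} = {x | f x ≠ x} \ {b} := by
        ext x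
        by_cases hx : x = b
        · subst hx
          simp [restrictTo_of_notMem]
        · simp [restrictTo_of_mem, hx]
      rw [this, Set.ncard_sdiff_singleton_of_mem hb, hN]
      rfl
    · have : restrictTo {b} f = e (f b) b := by
        refine end_ext fun x => ?_
        by_cases hx : x = b
        · subst hx
          rw [restrictTo_of_mem (Set.mem_singleton x), e_apply_self]
        · rw [restrictTo_of_notMem (B := {b}) hx, e_apply_of_ne hx]
      rw [this]
      exact e_mem_closure hb

/-- A permutation as a transformation. -/
def ofPerm {k : ℕ} (π : Equiv.Perm (Fin k)) : Function.End (Fin k) := fun x => π x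

/-- The image of `e a b` misses `b`, and this hole lets each transposition be carried out by
elementary moves, as in a sliding puzzle. -/
theorem perm_mul_e_mem_closure {k : ℕ} (π : Equiv.Perm (Fin k)) {a b : Fin k} (hab : a ≠ b) :
    ofPerm π * e a b ∈ Submonoid.closure (elementary k) := by
  induction π using Equiv.Perm.swap_induction_on' generalizing a b with
  | one => exact e_mem_closure hab
  | mul_swap π c d hcd ih =>
    have key : ∀ c, c ≠ b → ofPerm (π * Equiv.swap c b) * e a b ∈
        Submonoid.closure (elementary k) := by
      intro c hc
      have : ofPerm (π * Equiv.swap c b) * e a b =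
          ofPerm π * e b c * e a b := by
        refine end_ext fun x => ?_
        simp only [end_mul_apply, ofPerm, Equiv.Perm.mul_apply]
        have hne : e a b x ≠ b := by
          by_cases hx : x = b
          · rwa [hx, e_apply_self]
          · rwa [e_apply_of_ne hx]
        by_cases h : e a b x = c
        · rw [h, Equiv.swap_apply_left, e_apply_self]
        · rw [Equiv.swap_apply_of_ne_of_ne h hne, e_apply_of_ne h]
      rw [this]
      exact mul_mem (ih hc.symm) (e_mem_closure hab)
    by_cases hd : d = b
    · subst hd
      exact key c hcd
    by_cases hc : c = b
    · subst hc
      rw [Equiv.swap_comm]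
      exact key d hd
    -- Three moves through the hole: `c` to `b`, then `d` to `c`, then `b` to `d`.
    have : ofPerm (π * Equiv.swap c d) * e a b =
        ofPerm π * e d b * (e c d * (e b c * e a b)) := by
      refine end_ext fun x => ?_
      simp only [end_mul_apply, ofPerm, Equiv.Perm.mul_apply]
      have hne : e a b x ≠ b := by
        by_cases hx : x = b
        · rwa [hx, e_apply_self]
        · rwa [e_apply_of_ne hx]
      by_cases h : e a b x = c
      · rw [h, Equiv.swap_apply_left, e_apply_self, e_apply_of_ne (Ne.symm hd), e_apply_self]
      by_cases h' : e a b x = d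
      · rw [h', Equiv.swap_apply_right, e_apply_of_ne (Ne.symm hcd), e_apply_self,
          e_apply_of_ne hc]
      · rw [Equiv.swap_apply_of_ne_of_ne h h', e_apply_of_ne h, e_apply_of_ne h', e_apply_of_ne hne]
    rw [this]
    exact mul_mem (ih hd) (mul_mem (e_mem_closure hcd) (mul_mem (e_mem_closure (Ne.symm hc))
      (e_mem_closure hab)))

/-- Every transformation of a finite set is a permutation times an idempotent. -/
theorem exists_perm_comp_idempotent {k : ℕ} (f : Function.End (Fin k)) :
    ∃ (π : Equiv.Perm (Fin k)) (ε : Function.End (Fin k)), IsIdempotentElem ε ∧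
      f = ofPerm π * ε := by
  classical
  choose s hs using fun y : Set.range (f : Fin k → Fin k) => y.2
  let ε : Function.End (Fin k) := fun x => s ⟨f x, x, rfl⟩
  have hfε : ∀ x, f (ε x) = f x := fun x => hs ⟨f x, x, rfl⟩
  have hε : ∀ x y, f x = f y → ε x = ε y := fun x y h => by
    have : (⟨f x, x, rfl⟩ : Set.range (f : Fin k → Fin k)) = ⟨f y, y, rfl⟩ := Subtype.ext h
    exact congrArg s this
  obtain ⟨g, hg⟩ := Finset.exists_equiv_extend_of_card_eq (α := Fin k) (t := Finset.univ)
    (by simp) (s := Finset.univ.image ε) (f := f) (Finset.subset_univ _) (by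
      intro x hx y hy hxy
      obtain ⟨x', -, rfl⟩ := Finset.mem_image.1 (Finset.mem_coe.1 hx)
      obtain ⟨y', -, rfl⟩ := Finset.mem_image.1 (Finset.mem_coe.1 hy)
      rw [hfε, hfε] at hxy
      exact hε _ _ hxy)
  refine ⟨g.trans (Equiv.subtypeUnivEquiv (fun x => Finset.mem_univ x)), ε, ?_, ?_⟩
  · exact isIdempotentElem_end_iff.2 fun x => hε _ _ (hfε x)
  · funext x
    have := hg (ε x) (Finset.mem_image_of_mem _ (Finset.mem_univ x))
    rw [hfε] at this
    exact this.symm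

/-- Write `f` as a permutation times an idempotent. The idempotent is not the empty product, since
`f` is not bijective, so its leftmost elementary factor can absorb the permutation. -/
theorem singular_mem_closure_elementary {k : ℕ} {f : Function.End (Fin k)} (hf : f ∈ singular k) :
    f ∈ Submonoid.closure (elementary k) := by
  obtain ⟨π, ε, hε, rfl⟩ := exists_perm_comp_idempotent f
  have hmem := idempotent_mem_closure_elementary hε
  induction hmem using Submonoid.closure_induction_left with
  | one => exact absurd π.bijective hf
  | mul_left x hx y hy =>
    obtain ⟨i, j, hij, rfl⟩ := hx
    rw [← mul_assoc]
    exact mul_mem (perm_mul_e_mem_closure π hij) hy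

theorem E_eq_closure_elementary (k : ℕ) : E k = Submonoid.closure (elementary k) := by
  refine le_antisymm (Submonoid.closure_le.2 fun f hf => idempotent_mem_closure_elementary hf.2)
    (Submonoid.closure_mono ?_)
  rintro f ⟨i, j, hij, rfl⟩
  exact ⟨trivial, e_isIdempotentElem hij⟩

theorem singular_subset_E (k : ℕ) : singular k ⊆ E k := fun f hf => by
  rw [E_eq_closure_elementary]
  exact singular_mem_closure_elementary hf

/-! ### Transformations preserving the partition into blocks -/

section Blocks

variable {m n : ℕ}

theorem mem_TXP_iff {f : Function.End (Fin m × Fin n)} :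
    f ∈ TXP m n ↔ ∀ i, ∃ j, ∀ p, p.1 = i → (f p).1 = j := Iff.rfl

theorem block_eq_of_mem_TXP {f : Function.End (Fin m × Fin n)} (hf : f ∈ TXP m n)
    {p q : Fin m × Fin n} (h : p.1 = q.1) : (f p).1 = (f q).1 := by
  obtain ⟨j, hj⟩ := mem_TXP_iff.1 hf q.1
  rw [hj p h, hj q rfl]

theorem EXP_le_TXP : EXP m n ≤ TXP m n := Submonoid.closure_le.2 fun _ hf => hf.1

theorem idempotents_EXP : idempotents (EXP m n) = idempotents (TXP m n) :=
  Set.Subset.antisymm (fun _ hf => ⟨EXP_le_TXP hf.1, hf.2⟩)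
    fun _ hf => ⟨Submonoid.subset_closure hf, hf.2⟩

theorem inBlock_apply (i : Fin m) (g : Function.End (Fin n)) (p : Fin m × Fin n) :
    inBlock i g p = (p.1, if p.1 = i then g p.2 else p.2) := rfl

theorem inBlock_apply_self (i : Fin m) (g : Function.End (Fin n)) (x : Fin n) :
    inBlock i g (i, x) = (i, g x) := by simp [inBlock_apply]

theorem inBlock_apply_of_ne {i : Fin m} {g : Function.End (Fin n)} {p : Fin m × Fin n}
    (h : p.1 ≠ i) : inBlock i g p = p := by simp [inBlock_apply, h]

/-- `g ↦ g^{(i)}` as a homomorphism. -/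
def inBlockHom (i : Fin m) : Function.End (Fin n) →* Function.End (Fin m × Fin n) where
  toFun := inBlock i
  map_one' := end_ext fun p => by
    rw [inBlock_apply, end_one_apply, end_one_apply, ite_self]
  map_mul' f g := end_ext fun p => by
    obtain ⟨k, x⟩ := p
    rw [end_mul_apply]
    by_cases h : k = i
    · subst h
      rw [inBlock_apply_self, inBlock_apply_self, inBlock_apply_self, end_mul_apply]
    · rw [inBlock_apply_of_ne h, inBlock_apply_of_ne h, inBlock_apply_of_ne h]

theorem inBlock_injective (i : Fin m) :
    Function.Injective (inBlock i : Function.End (Fin n) → Function.End (Fin m × Fin n)) := by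
  intro f g h
  refine end_ext fun x => ?_
  have := congrFun h (i, x)
  rw [inBlock_apply_self, inBlock_apply_self] at this
  exact congrArg Prod.snd this

theorem inBlock_isIdempotentElem (i : Fin m) {g : Function.End (Fin n)}
    (hg : IsIdempotentElem g) : IsIdempotentElem (inBlock i g) := hg.map (inBlockHom i)

theorem inBlock_mem_TXP (i : Fin m) (g : Function.End (Fin n)) : inBlock i g ∈ TXP m n :=
  mem_TXP_iff.2 fun k => ⟨k, fun _ hp => hp⟩

theorem inBlock_mem_idempotents (i : Fin m) {g : Function.End (Fin n)}
    (hg : IsIdempotentElem g) : inBlock i g ∈ idempotents (EXP m n) := by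
  rw [idempotents_EXP]
  exact ⟨inBlock_mem_TXP i g, inBlock_isIdempotentElem i hg⟩

theorem eTwist_apply (i j : Fin m) (f : Equiv.Perm (Fin n)) (p : Fin m × Fin n) :
    eTwist i j f p = if p.1 = j then (i, f p.2) else p := by
  by_cases h : p.1 = j
  · simp [eTwist, mk, h, e]
  · simp [eTwist, mk, h, e]

theorem eTwist_apply_self (i j : Fin m) (f : Equiv.Perm (Fin n)) (x : Fin n) :
    eTwist i j f (j, x) = (i, f x) := by simp [eTwist_apply]

theorem eTwist_apply_of_ne {i j : Fin m} {f : Equiv.Perm (Fin n)} {p : Fin m × Fin n}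
    (h : p.1 ≠ j) : eTwist i j f p = p := by simp [eTwist_apply, h]

theorem eTwist_fst_ne {i j : Fin m} (hij : i ≠ j) (f : Equiv.Perm (Fin n)) (p : Fin m × Fin n) :
    (eTwist i j f p).1 ≠ j := by
  by_cases h : p.1 = j
  · simpa [eTwist_apply, h] using hij
  · rwa [eTwist_apply_of_ne h]

theorem eTwist_isIdempotentElem {i j : Fin m} (hij : i ≠ j) (f : Equiv.Perm (Fin n)) :
    IsIdempotentElem (eTwist i j f) :=
  isIdempotentElem_end_iff.2 fun p => eTwist_apply_of_ne (eTwist_fst_ne hij f p)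

theorem eTwist_mem_TXP (i j : Fin m) (f : Equiv.Perm (Fin n)) : eTwist i j f ∈ TXP m n :=
  mem_TXP_iff.2 fun k => ⟨e i j k, fun p hp => by rw [← hp]; rfl⟩

theorem eTwist_mem_idempotents {i j : Fin m} (hij : i ≠ j) (f : Equiv.Perm (Fin n)) :
    eTwist i j f ∈ idempotents (EXP m n) := by
  rw [idempotents_EXP]
  exact ⟨eTwist_mem_TXP i j f, eTwist_isIdempotentElem hij f⟩

theorem eTwist_injOn (i j : Fin m) (f : Equiv.Perm (Fin n)) :
    Set.InjOn (eTwist i j f) {p | p.1 ≠ i} := by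
  rintro ⟨k, x⟩ hk ⟨l, y⟩ hl h
  simp only [Set.mem_ofPred_eq] at hk hl
  rw [eTwist_apply, eTwist_apply] at h
  dsimp only at h
  split_ifs at h with h1 h2 h2
  · simp only [Prod.mk.injEq, EmbeddingLike.apply_eq_iff_eq, true_and] at h
    rw [h1, h2, h]
  · exact absurd (congrArg Prod.fst h).symm hl
  · exact absurd (congrArg Prod.fst h) hk
  · exact h

theorem eTwist_inj (hn : 0 < n) {i j i' j' : Fin m} {f f' : Equiv.Perm (Fin n)} (hij : i ≠ j)
    (h : eTwist i j f = eTwist i' j' f') : i = i' ∧ j = j' ∧ f = f' := by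
  have hj : j = j' := by
    by_contra hne
    have := congrFun h (j, ⟨0, hn⟩)
    rw [eTwist_apply_self, eTwist_apply_of_ne hne] at this
    exact hij (congrArg Prod.fst this)
  subst hj
  have key : ∀ x, (i, f x) = (i', f' x) := fun x => by
    have := congrFun h (j, x)
    rwa [eTwist_apply_self, eTwist_apply_self] at this
  exact ⟨congrArg Prod.fst (key ⟨0, hn⟩), rfl, Equiv.ext fun x => congrArg Prod.snd (key x)⟩

/-- The set of all `e_{ij;f}` with `i ≠ j`. -/
def twists (m n : ℕ) : Set (Function.End (Fin m × Fin n)) :=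
  {t | ∃ i j f, i ≠ j ∧ eTwist i j f = t}

/-- `U` contains an element `e_{ij;f}`, which moves the block `j` onto the block `i`. -/
def Moves (U : Set (Function.End (Fin m × Fin n))) (j i : Fin m) : Prop :=
  i ≠ j ∧ ∃ f, eTwist i j f ∈ U

/-! ### A sufficient condition for generating `𝓔(X,𝓟)` -/

/-- Along a path of moves, a free block can be transported backwards. -/
theorem exists_mul_fst_ne_of_reflTransGen {U : Set (Function.End (Fin m × Fin n))}
    {h' h : Fin m} (hp : Relation.ReflTransGen (Moves U) h' h) {R : Set (Fin m × Fin n)}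
    {y : Function.End (Fin m × Fin n)} (hy : ∀ p, (y p).1 ≠ h) (hi : Set.InjOn y R) :
    ∃ v ∈ Submonoid.closure U, (∀ p, ((v * y) p).1 ≠ h') ∧
      Set.InjOn (v * y : Function.End (Fin m × Fin n)) R := by
  induction hp generalizing y with
  | refl => exact ⟨1, one_mem _, hy, hi⟩
  | @tail c h _ hc ih =>
    obtain ⟨hne, f, hf⟩ := hc
    -- Block `h` is free, so `eTwist h c f` moves block `c` onto it without collisions, and `c`
    -- becomes free.
    obtain ⟨v, hv, hv1, hv2⟩ := ih (y := eTwist h c f * y) (fun p => eTwist_fst_ne hne f _)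
      ((eTwist_injOn h c f).comp hi fun p _ => hy p)
    exact ⟨v * eTwist h c f, mul_mem hv (Submonoid.subset_closure hf),
      by rwa [mul_assoc], by rwa [mul_assoc]⟩

/-- `eTwist j i f⁻¹` has the kernel of `eTwist i j f` but misses block `i` instead of `j`.
Transporting the free block back along a path from `j` to `i` corrects the image, and a power of the
product is then `eTwist i j f`. -/
theorem eTwist_mem_closure {U : Set (Function.End (Fin m × Fin n))}
    (hb : ∀ i j f, i ≠ j → eTwist i j f ∈ U ∨ eTwist j i f⁻¹ ∈ U)
    (hc : ∀ i j, Relation.ReflTransGen (Moves U) i j) {i j : Fin m} (hij : i ≠ j)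
    (f : Equiv.Perm (Fin n)) : eTwist i j f ∈ Submonoid.closure U := by
  rcases hb i j f hij with h | h
  · exact Submonoid.subset_closure h
  obtain ⟨v, hv, hv1, hv2⟩ := exists_mul_fst_ne_of_reflTransGen (hc j i)
    (fun p => eTwist_fst_ne hij.symm f⁻¹ p) (eTwist_injOn j i f⁻¹)
  have h1 : eTwist j i f⁻¹ * eTwist i j f = eTwist j i f⁻¹ := by
    refine end_ext fun p => ?_
    obtain ⟨k, x⟩ := p
    rw [end_mul_apply]
    by_cases hk : k = j
    · subst hk
      rw [eTwist_apply_self, eTwist_apply_self, eTwist_apply_of_ne hij.symm]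
      simp
    · rw [eTwist_apply_of_ne (i := i) (j := j) hk]
  obtain ⟨N, hN⟩ := exists_pow_eq_of_mul_eq (z := v * eTwist j i f⁻¹) (t := eTwist i j f)
    (by rw [mul_assoc, h1]) (end_ext fun p => eTwist_apply_of_ne (hv1 p))
    (hv2.mono (by rintro _ ⟨p, rfl⟩; exact eTwist_fst_ne hij f p))
  rw [← hN]
  exact pow_mem (mul_mem hv (Submonoid.subset_closure h)) N

/-- Block `b` is mapped to itself, or bijectively onto another block (a twist), or non-bijectively
into another block; in the last case a singular map inside `b`, which lies in `E n`, is followed by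
an untwisted move. -/
theorem restrictTo_block_mem {T : Submonoid (Function.End (Fin m × Fin n))}
    (ha : ∀ i, ∀ g ∈ E n, inBlock i g ∈ T) (hb : ∀ i j f, i ≠ j → eTwist i j f ∈ T)
    {F : Function.End (Fin m × Fin n)} (hF : F ∈ idempotents (TXP m n)) (b : Fin m) :
    restrictTo (block n b) F ∈ T := by
  obtain ⟨c, hc⟩ := mem_TXP_iff.1 hF.1 b
  let h : Function.End (Fin n) := fun x => (F (b, x)).2
  have hFb : ∀ x, F (b, x) = (c, h x) := fun x => Prod.ext (hc _ rfl) rfl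
  by_cases hcb : c = b
  · subst hcb
    have hh : IsIdempotentElem h := isIdempotentElem_end_iff.2 fun x => by
      have := isIdempotentElem_end_iff.1 hF.2 (c, x)
      rw [hFb x, hFb (h x)] at this
      exact (Prod.mk.injEq .. ▸ this).2
    have : restrictTo (block n c) F = inBlock c h := by
      refine end_ext fun p => ?_
      obtain ⟨k, x⟩ := p
      by_cases hk : k = c
      · subst hk
        rw [restrictTo_of_mem (show (k, x) ∈ block n k from rfl), inBlock_apply_self, hFb]
      · rw [restrictTo_of_notMem (show (k, x) ∉ block n c from hk), inBlock_apply_of_ne hk]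
    rw [this]
    exact ha _ _ (Submonoid.subset_closure ⟨trivial, hh⟩)
  · by_cases hbij : Function.Bijective (h : Fin n → Fin n)
    · have : restrictTo (block n b) F = eTwist c b (Equiv.ofBijective h hbij) := by
        refine end_ext fun p => ?_
        obtain ⟨k, x⟩ := p
        by_cases hk : k = b
        · subst hk
          rw [restrictTo_of_mem (show (k, x) ∈ block n k from rfl), eTwist_apply_self, hFb]
          rfl
        · rw [restrictTo_of_notMem (show (k, x) ∉ block n b from hk), eTwist_apply_of_ne hk]
      rw [this]
      exact hb _ _ _ hcb
    · have : restrictTo (block n b) F = eTwist c b 1 * inBlock b h := by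
        refine end_ext fun p => ?_
        obtain ⟨k, x⟩ := p
        rw [end_mul_apply]
        by_cases hk : k = b
        · subst hk
          rw [restrictTo_of_mem (show (k, x) ∈ block n k from rfl), inBlock_apply_self,
            eTwist_apply_self, hFb]
          rfl
        · rw [restrictTo_of_notMem (show (k, x) ∉ block n b from hk), inBlock_apply_of_ne hk,
            eTwist_apply_of_ne hk]
      rw [this]
      exact mul_mem (hb _ _ _ hcb) (ha _ _ (singular_subset_E n hbij))

/-- Induction on the number of blocks not fixed pointwise, peeling off one such block at each step.
-/
theorem EXP_le_of_inBlock_mem_of_eTwist_mem {T : Submonoid (Function.End (Fin m × Fin n))}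
    (ha : ∀ i, ∀ g ∈ E n, inBlock i g ∈ T) (hb : ∀ i j f, i ≠ j → eTwist i j f ∈ T) :
    EXP m n ≤ T := by
  refine Submonoid.closure_le.2 fun F hF => ?_
  obtain ⟨N, hN⟩ : ∃ N, {k | ∃ x, F (k, x) ≠ (k, x)}.ncard = N := ⟨_, rfl⟩
  induction N generalizing F with
  | zero =>
    rw [Set.ncard_eq_zero] at hN
    have : F = 1 := end_ext fun p => by
      by_contra hp
      exact (Set.mem_empty_iff_false p.1).1 (hN ▸ ⟨p.2, hp⟩)
    rw [this]
    exact one_mem _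
  | succ N ih =>
    obtain ⟨b, hb'⟩ : {k | ∃ x, F (k, x) ≠ (k, x)}.Nonempty := by
      rw [← Set.ncard_pos]
      omega
    have hmul := restrictTo_compl_mul_restrictTo (block n b) hF.2
    have h2 := restrictTo_block_mem ha hb hF b
    have h1 : restrictTo (block n b)ᶜ F ∈ T := by
      refine ih (restrictTo (block n b)ᶜ F) ⟨?_, restrictTo_isIdempotentElem _ hF.2⟩ ?_
      · refine mem_TXP_iff.2 fun k => ?_
        by_cases hk : k = b
        · refine ⟨b, fun p hp => ?_⟩
          rw [restrictTo_of_notMem (by simp [block, hp, hk]), hp, hk]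
        · obtain ⟨c, hc⟩ := mem_TXP_iff.1 hF.1 k
          refine ⟨c, fun p hp => ?_⟩
          rw [restrictTo_of_mem (by simp [block, hp, hk]), hc p hp]
      · have : {k | ∃ x, restrictTo (block n b)ᶜ F (k, x) ≠ (k, x)} =
            {k | ∃ x, F (k, x) ≠ (k, x)} \ {b} := by
          ext k
          by_cases hk : k = b
          · subst hk
            simp [restrictTo_of_notMem, block]
          · have : ∀ x, restrictTo (block n b)ᶜ F (k, x) = F (k, x) := fun x =>
              restrictTo_of_mem (by simp [block, hk])
            simp [this, hk]
        rw [this, Set.ncard_sdiff_singleton_of_mem hb', hN]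
        rfl
    rw [← hmul]
    exact mul_mem h1 h2

theorem isIdempotentGeneratingSet_of_moves {U : Set (Function.End (Fin m × Fin n))}
    (hU : U ⊆ idempotents (EXP m n))
    (ha : ∀ i, ∃ U', Submonoid.closure U' = E n ∧ inBlock i '' U' ⊆ U)
    (hb : ∀ i j f, i ≠ j → eTwist i j f ∈ U ∨ eTwist j i f⁻¹ ∈ U)
    (hc : ∀ i j, Relation.ReflTransGen (Moves U) i j) :
    IsIdempotentGeneratingSet (EXP m n) U := by
  refine ⟨hU, le_antisymm (Submonoid.closure_le.2 fun u hu => (hU hu).1) ?_⟩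
  refine EXP_le_of_inBlock_mem_of_eTwist_mem (fun i g hg => ?_) fun i j f hij =>
    eTwist_mem_closure hb hc hij f
  obtain ⟨U', hU', hsub⟩ := ha i
  rw [← hU'] at hg
  have : inBlockHom i g ∈ (Submonoid.closure U').map (inBlockHom i) := ⟨g, hg, rfl⟩
  rw [MonoidHom.map_mclosure] at this
  exact Submonoid.closure_mono hsub this

/-! ### Necessary conditions for generating `𝓔(X,𝓟)` -/

theorem exists_perm_of_injOn_block {y : Function.End (Fin m × Fin n)} {k : Fin m}
    (hi : ∀ p q : Fin m × Fin n, p.1 = k → q.1 = k → y p = y q → p = q) {c : Fin m}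
    (hc : ∀ p, p.1 = k → (y p).1 = c) :
    ∃ f : Equiv.Perm (Fin n), ∀ x, y (k, x) = (c, f x) := by
  have hinj : Function.Injective fun x => (y (k, x)).2 := fun x x' h =>
    congrArg Prod.snd (hi (k, x) (k, x') rfl rfl
      (Prod.ext (by rw [hc _ rfl, hc _ rfl]) h))
  exact ⟨Equiv.ofBijective _ (Finite.injective_iff_bijective.1 hinj),
    fun x => Prod.ext (hc _ rfl) rfl⟩

/-- By injectivity each block other than `j` fills a whole block, and different ones fill different
blocks. So `m - 1` blocks are covered and `h` is the remaining one. -/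
theorem exists_range_superset (hn : 0 < n) {y : Function.End (Fin m × Fin n)} (hy : y ∈ TXP m n)
    {j : Fin m} (hi : Set.InjOn y {p | p.1 ≠ j}) :
    ∃ h, ∀ p : Fin m × Fin n, p.1 ≠ h → ∃ q, q.1 ≠ j ∧ y q = p := by
  choose g hg using mem_TXP_iff.1 hy
  have hperm : ∀ k, k ≠ j → ∃ f : Equiv.Perm (Fin n), ∀ x, y (k, x) = (g k, f x) := fun k hk =>
    exists_perm_of_injOn_block (fun p q hp hq => hi (by simpa [hp]) (by simpa [hq])) (hg k)
  have hginj : Set.InjOn g ((Finset.univ.erase j : Finset (Fin m)) : Set (Fin m)) := by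
    intro k hk l hl hkl
    simp only [Finset.coe_erase, Finset.coe_univ, Set.mem_sdiff, Set.mem_univ,
      Set.mem_singleton_iff, true_and] at hk hl
    obtain ⟨f, hf⟩ := hperm k hk
    have : y (k, f.symm (y (l, ⟨0, hn⟩)).2) = y (l, ⟨0, hn⟩) := by
      rw [hf, f.apply_symm_apply, hkl, ← hg l (l, ⟨0, hn⟩) rfl]
    exact congrArg Prod.fst (hi (x₁ := (k, _)) hk (x₂ := (l, _)) hl this)
  have hcard : ((Finset.univ.erase j).image g)ᶜ.card = 1 := by
    rw [Finset.card_compl, Finset.card_image_of_injOn hginj,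
      Finset.card_erase_of_mem (Finset.mem_univ j), Finset.card_univ, Fintype.card_fin]
    have := j.pos
    omega
  obtain ⟨h, hh⟩ := Finset.card_eq_one.1 hcard
  refine ⟨h, fun p hp => ?_⟩
  have : p.1 ∈ (Finset.univ.erase j).image g := by
    by_contra hcon
    rw [← Finset.mem_compl, hh, Finset.mem_singleton] at hcon
    exact hp hcon
  obtain ⟨k, hk, hkp⟩ := Finset.mem_image.1 this
  obtain ⟨f, hf⟩ := hperm k (Finset.ne_of_mem_erase hk)
  exact ⟨(k, f.symm p.2), Finset.ne_of_mem_erase hk, by rw [hf, hkp, f.apply_symm_apply]⟩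

/-- A moved point `p` and `x p` have the same image, so for `p` outside `h` injectivity puts `x p`
in `h`. One such point carries its whole block bijectively onto `h`. Then every point of `h` is a
value, hence fixed, and no further block can move without a collision. -/
theorem fixes_or_eq_eTwist {x : Function.End (Fin m × Fin n)} (hx : x ∈ idempotents (TXP m n))
    {h : Fin m} (hi : Set.InjOn x {p | p.1 ≠ h}) :
    (∀ p, p.1 ≠ h → x p = p) ∨ ∃ b f, h ≠ b ∧ x = eTwist h b f := by
  have hidem := isIdempotentElem_end_iff.1 hx.2
  by_cases hfix : ∀ p, p.1 ≠ h → x p = p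
  · exact Or.inl hfix
  right
  have hmove : ∀ p, p.1 ≠ h → x p ≠ p → (x p).1 = h := fun p hp hxp => by
    by_contra hne
    exact hxp (hi hne hp (hidem p))
  push Not at hfix
  obtain ⟨p₀, hp₀, hxp₀⟩ := hfix
  have hc : ∀ p, p.1 = p₀.1 → (x p).1 = h := fun p hp => by
    rw [block_eq_of_mem_TXP hx.1 hp, hmove p₀ hp₀ hxp₀]
  obtain ⟨f, hf⟩ := exists_perm_of_injOn_block
    (fun p q hp hq => hi (by simpa [hp]) (by simpa [hq])) hc
  refine ⟨p₀.1, f, Ne.symm hp₀, end_ext fun q => ?_⟩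
  by_cases hq : q.1 = p₀.1
  · obtain ⟨k, z⟩ := q
    simp only at hq
    subst hq
    rw [hf, eTwist_apply_self]
  rw [eTwist_apply_of_ne hq]
  by_cases hqh : q.1 = h
  · have : q = x (p₀.1, f.symm q.2) := by
      rw [hf, f.apply_symm_apply, ← hqh]
    rw [this, hidem]
  · by_contra hne
    have hxq := hmove q hqh hne
    have : x q = x (p₀.1, f.symm (x q).2) := by
      rw [hf, f.apply_symm_apply, ← hxq]
    have hqp := hi (x₂ := (p₀.1, f.symm (x q).2)) hqh hp₀ this
    exact hq (by rw [hqp])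

theorem eq_one_or_eq_eTwist {x : Function.End (Fin m × Fin n)} (hx : x ∈ idempotents (TXP m n))
    (hb : ∀ p q, p.1 = q.1 → x p = x q → p = q) {h : Fin m} (hfix : ∀ p, p.1 ≠ h → x p = p) :
    x = 1 ∨ ∃ c f, c ≠ h ∧ x = eTwist c h f := by
  obtain ⟨c, hc⟩ := mem_TXP_iff.1 hx.1 h
  by_cases hch : c = h
  · left
    refine end_ext fun p => ?_
    by_cases hp : p.1 = h
    · exact hb _ _ (by rw [hc p hp, hch]; exact hp.symm)
        (isIdempotentElem_end_iff.1 hx.2 p)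
    · exact hfix p hp
  · right
    obtain ⟨f, hf⟩ := exists_perm_of_injOn_block (fun p q hp hq => hb p q (hp.trans hq.symm)) hc
    refine ⟨c, f, hch, end_ext fun p => ?_⟩
    by_cases hp : p.1 = h
    · obtain ⟨k, z⟩ := p
      simp only at hp
      subst hp
      rw [hf, eTwist_apply_self]
    · rw [hfix p hp, eTwist_apply_of_ne hp]

theorem eq_one_or_fst_ne_of_mem_closure_twists {U : Set (Function.End (Fin m × Fin n))}
    (hU : U ⊆ twists m n) {y : Function.End (Fin m × Fin n)} (hy : y ∈ Submonoid.closure U) :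
    y = 1 ∨ ∃ h, ∀ p, (y p).1 ≠ h := by
  induction hy using Submonoid.closure_induction_left with
  | one => exact Or.inl rfl
  | mul_left x hx y hy =>
    obtain ⟨i, j, f, hij, rfl⟩ := hU hx
    exact Or.inr ⟨j, fun p => eTwist_fst_ne hij f _⟩

/-- Peel off the leftmost factor `x`. The rest `y` covers all blocks except some `h`, so `x` is
injective outside `h`: it is a twist or fixes everything outside `h`. In the second case, if `y ≠ 1`
then `y` misses exactly `h` and `x * y = y`; if `y = 1` then injectivity on blocks makes `x` a twist
or `1`. -/
theorem mem_closure_inter_twists (hn : 0 < n) {U : Set (Function.End (Fin m × Fin n))}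
    (hU : U ⊆ idempotents (TXP m n)) {y : Function.End (Fin m × Fin n)}
    (hy : y ∈ Submonoid.closure U) {j : Fin m} (hi : Set.InjOn y {p | p.1 ≠ j})
    (hb : ∀ p q, p.1 = q.1 → y p = y q → p = q) : y ∈ Submonoid.closure (U ∩ twists m n) := by
  induction hy using Submonoid.closure_induction_left with
  | one => exact one_mem _
  | mul_left x hx y hy ih =>
    have hyi : Set.InjOn y {p | p.1 ≠ j} := fun p hp q hq h => hi hp hq (congrArg x h)
    have hy' := ih hyi fun p q hpq h => hb p q hpq (congrArg x h)
    have hyT : y ∈ TXP m n := Submonoid.closure_le.2 (fun u hu => (hU hu).1) hy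
    obtain ⟨h, hh⟩ := exists_range_superset hn hyT hyi
    have hxi : Set.InjOn x {p | p.1 ≠ h} := by
      intro p hp q hq hpq
      obtain ⟨p', hp', rfl⟩ := hh p hp
      obtain ⟨q', hq', rfl⟩ := hh q hq
      exact congrArg y (hi hp' hq' hpq)
    rcases fixes_or_eq_eTwist (hU hx) hxi with hfix | ⟨b, f, hbh, rfl⟩
    · rcases eq_one_or_fst_ne_of_mem_closure_twists Set.inter_subset_right hy' with rfl | ⟨h', hh'⟩
      · rw [mul_one] at hb ⊢
        rcases eq_one_or_eq_eTwist (hU hx) hb hfix with rfl | ⟨c, f, hch, rfl⟩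
        · exact one_mem _
        · exact Submonoid.subset_closure ⟨hx, c, h, f, hch, rfl⟩
      · have hheq : h' = h := by
          by_contra hne
          obtain ⟨q, -, hq⟩ := hh (h', ⟨0, hn⟩) hne
          exact hh' q (by rw [hq])
        have : x * y = y := end_ext fun p => hfix _ (hheq ▸ hh' p)
        rwa [this]
    · exact mul_mem (Submonoid.subset_closure ⟨hx, h, b, f, hbh, rfl⟩) hy'

theorem eTwist_mem_closure_inter_twists (hn : 0 < n) {U : Set (Function.End (Fin m × Fin n))}
    (hU : IsIdempotentGeneratingSet (EXP m n) U) {i j : Fin m} (hij : i ≠ j)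
    (f : Equiv.Perm (Fin n)) : eTwist i j f ∈ Submonoid.closure (U ∩ twists m n) := by
  have hmem : eTwist i j f ∈ Submonoid.closure U := by
    rw [hU.2]
    exact (eTwist_mem_idempotents hij f).1
  refine mem_closure_inter_twists hn (idempotents_EXP ▸ hU.1) hmem (j := j) ?_ ?_
  · intro p hp q hq h
    rwa [eTwist_apply_of_ne hp, eTwist_apply_of_ne hq] at h
  · intro p q hpq h
    by_cases hp : p.1 = j
    · exact eTwist_injOn i j f (by simpa [hp] using hij.symm)
        (by simpa [← hpq, hp] using hij.symm) h
    · rwa [eTwist_apply_of_ne hp, eTwist_apply_of_ne (hpq ▸ hp)] at h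

/-- The rightmost factor `eTwist a b g` identifies `(b, x)` with `(a, g x)`, so the product does
too. The only non-trivial identifications made by `eTwist i j f` are those of `(j, x)` with `(i, f
x)`, which leaves the two listed factors. -/
theorem eTwist_mem_or_of_mem_closure (hn : 0 < n) {U : Set (Function.End (Fin m × Fin n))}
    (hU : U ⊆ twists m n) {i j : Fin m} (hij : i ≠ j) {f : Equiv.Perm (Fin n)}
    (hf : eTwist i j f ∈ Submonoid.closure U) : eTwist i j f ∈ U ∨ eTwist j i f⁻¹ ∈ U := by
  generalize hy : eTwist i j f = y at hf
  induction hf using Submonoid.closure_induction_right with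
  | one => exact absurd (congrArg Prod.fst (congrFun hy (j, ⟨0, hn⟩))) (by
      rw [eTwist_apply_self]
      exact hij)
  | mul_right y' _ t ht =>
    obtain ⟨a, b, g, hab, rfl⟩ := hU ht
    have key : ∀ x, eTwist i j f (b, x) = eTwist i j f (a, g x) := fun x => by
      rw [hy, end_mul_apply, end_mul_apply, eTwist_apply_self, eTwist_apply_of_ne (p := (a, g x)) hab]
    rw [← hy]
    by_cases hbj : b = j
    · subst hbj
      have key' : ∀ x, (i, f x) = (a, g x) := fun x => by
        have := key x
        rwa [eTwist_apply_self, eTwist_apply_of_ne (p := (a, g x)) hab] at this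
      have hia : i = a := congrArg Prod.fst (key' ⟨0, hn⟩)
      have hfg : f = g := Equiv.ext fun x => congrArg Prod.snd (key' x)
      subst hia hfg
      exact Or.inl ht
    by_cases haj : a = j
    · subst haj
      have key' : ∀ x, (b, x) = (i, f (g x)) := fun x => by
        have := key x
        rwa [eTwist_apply_self, eTwist_apply_of_ne (p := (b, x)) hbj] at this
      have hib : b = i := congrArg Prod.fst (key' ⟨0, hn⟩)
      have hfg : f⁻¹ = g := inv_eq_of_mul_eq_one_right
        (Equiv.ext fun x => (congrArg Prod.snd (key' x)).symm)
      subst hib hfg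
      exact Or.inr ht
    · have := key ⟨0, hn⟩
      rw [eTwist_apply_of_ne (by exact hbj), eTwist_apply_of_ne (by exact haj)] at this
      exact absurd (congrArg Prod.fst this).symm hab

theorem reflTransGen_of_mem_closure {U : Set (Function.End (Fin m × Fin n))}
    {y : Function.End (Fin m × Fin n)} (hy : y ∈ Submonoid.closure (U ∩ twists m n))
    (p : Fin m × Fin n) : Relation.ReflTransGen (Moves U) p.1 (y p).1 := by
  induction hy using Submonoid.closure_induction_left with
  | one => exact Relation.ReflTransGen.refl
  | mul_left x hx y hy ih =>
    obtain ⟨hxU, i, j, f, hij, rfl⟩ := hx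
    rw [end_mul_apply]
    by_cases h : (y p).1 = j
    · refine ih.tail ?_
      rw [eTwist_apply, if_pos h, h]
      exact ⟨hij, f, hxU⟩
    · rwa [eTwist_apply_of_ne h]

/-- A product that acts injectively on the set of blocks and on each block other than `i` has only
factors of the form `inBlock i g`: peeling from the left, each factor is an idempotent inheriting
both kinds of injectivity, so it preserves every block and is the identity off block `i`. -/
theorem closure_preimage_inBlock {U : Set (Function.End (Fin m × Fin n))}
    (hU : IsIdempotentGeneratingSet (EXP m n) U) (i : Fin m) :
    IsIdempotentGeneratingSet (E n) (inBlock i ⁻¹' U) := by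
  have hidem : inBlock i ⁻¹' U ⊆ idempotents (E n) := fun g hg => by
    have : IsIdempotentElem g := by
      refine inBlock_injective i ?_
      exact ((inBlockHom i).map_mul g g).trans (hU.1 hg).2
    exact ⟨Submonoid.subset_closure ⟨trivial, this⟩, this⟩
  refine ⟨hidem, le_antisymm (Submonoid.closure_le.2 fun g hg => (hidem hg).1) ?_⟩
  have hUT : U ⊆ idempotents (TXP m n) := idempotents_EXP ▸ hU.1
  have key : ∀ y ∈ Submonoid.closure U, (∀ p q, (y p).1 = (y q).1 → p.1 = q.1) →
      (∀ p q, p.1 = q.1 → p.1 ≠ i → y p = y q → p = q) →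
      ∃ g ∈ Submonoid.closure (inBlock i ⁻¹' U), inBlock i g = y := by
    intro y hy
    induction hy using Submonoid.closure_induction_left with
    | one => exact fun _ _ => ⟨1, one_mem _, (inBlockHom i).map_one⟩
    | mul_left x hx y hy ih =>
      intro h1 h2
      obtain ⟨g, hg, rfl⟩ := ih
        (fun p q h => h1 p q (block_eq_of_mem_TXP (hUT hx).1 h))
        (fun p q h hp hpq => h2 p q h hp (congrArg x hpq))
      have hidem := isIdempotentElem_end_iff.1 (hUT hx).2
      have hx1 : ∀ p, (x p).1 = p.1 := fun p => by
        refine h1 (x p) p ?_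
        rw [end_mul_apply, end_mul_apply]
        rw [block_eq_of_mem_TXP (hUT hx).1 (show (inBlock i g (x p)).1 = (x p).1 from rfl),
          block_eq_of_mem_TXP (hUT hx).1 (show (inBlock i g p).1 = p.1 from rfl), hidem]
      have hx2 : ∀ p, p.1 ≠ i → x p = p := fun p hp => by
        have hxp : (x p).1 ≠ i := by rwa [hx1]
        refine h2 _ _ (hx1 p) hxp ?_
        rw [end_mul_apply, end_mul_apply, inBlock_apply_of_ne hp, inBlock_apply_of_ne hxp, hidem]
      let g₁ : Function.End (Fin n) := fun z => (x (i, z)).2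
      have hxi : inBlock i g₁ = x := by
        refine end_ext fun p => ?_
        obtain ⟨k, z⟩ := p
        by_cases hk : k = i
        · subst hk
          rw [inBlock_apply_self]
          exact Prod.ext (hx1 (k, z)).symm rfl
        · rw [inBlock_apply_of_ne hk, hx2 _ hk]
      refine ⟨g₁ * g, mul_mem (Submonoid.subset_closure ?_) hg,
        ((inBlockHom i).map_mul g₁ g).trans (congrArg (· * inBlock i g) hxi)⟩
      rw [Set.mem_preimage, hxi]
      exact hx
  intro g hg
  have hmem : inBlock i g ∈ Submonoid.closure U := by
    rw [hU.2]
    have : inBlockHom i g ∈ (E n).map (inBlockHom i) := ⟨g, hg, rfl⟩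
    rw [E, idempotentGenerated, MonoidHom.map_mclosure] at this
    refine Submonoid.closure_le.2 ?_ this
    rintro _ ⟨u, hu, rfl⟩
    exact (inBlock_mem_idempotents i hu.2).1
  obtain ⟨g', hg', h⟩ := key _ hmem (fun p q h => h) (fun p q h hp hpq => by
    rwa [inBlock_apply_of_ne hp, inBlock_apply_of_ne (h ▸ hp)] at hpq)
  rwa [← inBlock_injective i h]

theorem IsIdempotentGeneratingSet.eTwist_mem_or (hn : 0 < n)
    {U : Set (Function.End (Fin m × Fin n))} (hU : IsIdempotentGeneratingSet (EXP m n) U)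
    {i j : Fin m} (hij : i ≠ j) (f : Equiv.Perm (Fin n)) :
    eTwist i j f ∈ U ∨ eTwist j i f⁻¹ ∈ U :=
  (eTwist_mem_or_of_mem_closure hn Set.inter_subset_right hij
    (eTwist_mem_closure_inter_twists hn hU hij f)).imp And.left And.left

theorem IsIdempotentGeneratingSet.reflTransGen_moves (hn : 0 < n)
    {U : Set (Function.End (Fin m × Fin n))} (hU : IsIdempotentGeneratingSet (EXP m n) U)
    (i j : Fin m) : Relation.ReflTransGen (Moves U) i j := by
  by_cases hij : i = j
  · rw [hij]
  have := reflTransGen_of_mem_closure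
    (eTwist_mem_closure_inter_twists hn hU (Ne.symm hij) 1) (i, ⟨0, hn⟩)
  rwa [eTwist_apply_self] at this

end Blocks

/-! ### Strongly connected digraphs -/

section Digraphs

theorem eq_univ_of_isStronglyConnected {V : Type*} {G : Digraph V} (hG : IsStronglyConnected G)
    {S : Set V} {v : V} (hv : v ∈ S) (hS : ∀ x ∈ S, ∀ y, G.Adj x y → y ∈ S) (w : V) : w ∈ S := by
  induction hG v w with
  | refl => exact hv
  | tail _ h ih => exact hS _ ih _ h

theorem IsStronglyConnected.of_reflTransGen {V : Type*} {G H : Digraph V}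
    (hG : IsStronglyConnected G) (h : ∀ x y, G.Adj x y → Relation.ReflTransGen H.Adj x y) :
    IsStronglyConnected H := fun u v => by
  induction hG u v with
  | refl => exact Relation.ReflTransGen.refl
  | tail _ h' ih => exact ih.trans (h _ _ h')

/-- The digraph `G` with the edge from `u` to `v` removed. -/
def deleteEdge {V : Type*} (G : Digraph V) (u v : V) : Digraph V :=
  ⟨fun x y => G.Adj x y ∧ ¬(x = u ∧ y = v)⟩

/-- Take for `R` the vertices still reachable from `u`. If `v` were among them, the deleted edge
could be bypassed. -/
theorem exists_cut_of_not_isStronglyConnected_deleteEdge {V : Type*} {G : Digraph V}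
    (hG : IsStronglyConnected G) {u v : V} (h : ¬ IsStronglyConnected (deleteEdge G u v)) :
    ∃ R : Set V, u ∈ R ∧ v ∉ R ∧ ∀ x ∈ R, ∀ y ∉ R, G.Adj x y → x = u ∧ y = v := by
  refine ⟨{x | Relation.ReflTransGen (deleteEdge G u v).Adj u x}, Relation.ReflTransGen.refl,
    fun hv => h (hG.of_reflTransGen fun x y hxy => ?_), fun x hx y hy hxy => ?_⟩
  · by_cases hc : x = u ∧ y = v
    · rw [hc.1, hc.2]
      exact hv
    · exact Relation.ReflTransGen.single ⟨hxy, hc⟩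
  · by_contra hc
    exact hy (Relation.ReflTransGen.tail hx ⟨hxy, hc⟩)

/-- In a strongly connected complete digraph with at least three vertices, one direction of every
double edge can be removed. -/
theorem isStronglyConnected_deleteEdge_or {V : Type*} {G : Digraph V}
    (hc : IsCompleteDigraph G) (hG : IsStronglyConnected G) {u v w : V} (hwu : w ≠ u)
    (hwv : w ≠ v) :
    IsStronglyConnected (deleteEdge G u v) ∨ IsStronglyConnected (deleteEdge G v u) := by
  by_contra! hcon
  obtain ⟨R, huR, hvR, hR⟩ := exists_cut_of_not_isStronglyConnected_deleteEdge hG hcon.1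
  obtain ⟨R', hvR', huR', hR'⟩ := exists_cut_of_not_isStronglyConnected_deleteEdge hG hcon.2
  -- The only exit from `R` starts at `u ∉ R'` and the only exit from `R'` at `v ∉ R`, so `R ∩ R'`
  -- has no exit and must be empty.
  have hdisj : ∀ z ∈ R, z ∉ R' := fun z hz hz' => by
    refine huR' (eq_univ_of_isStronglyConnected hG (S := R ∩ R') ⟨hz, hz'⟩ ?_ u).2
    rintro x ⟨hx, hx'⟩ y hxy
    constructor
    · by_contra hy
      exact huR' ((hR x hx y hy hxy).1 ▸ hx')
    · by_contra hy
      exact hvR ((hR' x hx' y hy hxy).1 ▸ hx)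
  -- Each of the two exits lands in the other set, so the union has no exit.
  have hcover : w ∈ R ∪ R' := by
    refine eq_univ_of_isStronglyConnected hG (S := R ∪ R') (Or.inl huR) ?_ w
    rintro x (hx | hx) y hxy
    · by_cases hy : y ∈ R
      · exact Or.inl hy
      · exact Or.inr ((hR x hx y hy hxy).2 ▸ hvR')
    · by_cases hy : y ∈ R'
      · exact Or.inr hy
      · exact Or.inl ((hR' x hx y hy hxy).2 ▸ huR)
  -- If `w ∈ R`, the edge joining `w` and `v` leaves `R` or leaves `R'`, and either way `w = u`. The
  -- other case is symmetric.
  rcases hcover with hw | hw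
  · rcases hc.2 w v hwv with h | h
    · exact hwu (hR w hw v hvR h).1
    · exact hwu (hR' v hvR' w (hdisj w hw) h).2
  · rcases hc.2 w u hwu with h | h
    · exact hwv (hR' w hw u huR' h).1
    · exact hwv (hR u huR w (fun h' => hdisj w h' hw) h).2

theorem isCompleteDigraph_deleteEdge {V : Type*} {G : Digraph V} (hc : IsCompleteDigraph G)
    {u v : V} (hvu : G.Adj v u) : IsCompleteDigraph (deleteEdge G u v) := by
  refine ⟨fun x hx => hc.1 x hx.1, fun x y hxy => ?_⟩
  by_cases h1 : x = u ∧ y = v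
  · right
    obtain ⟨rfl, rfl⟩ := h1
    exact ⟨hvu, fun h => hxy h.2⟩
  by_cases h2 : y = u ∧ x = v
  · left
    obtain ⟨rfl, rfl⟩ := h2
    exact ⟨hvu, fun h => hxy h.1⟩
  exact (hc.2 x y hxy).imp (fun h => ⟨h, h1⟩) fun h => ⟨h, h2⟩

/-- A strongly connected complete digraph on at least three vertices contains a strongly connected
tournament. -/
theorem exists_isTournament_le {V : Type*} [Finite V] (hV : ∀ u v : V, ∃ w, w ≠ u ∧ w ≠ v)
    {G : Digraph V} (hc : IsCompleteDigraph G) (hG : IsStronglyConnected G) :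
    ∃ T ≤ G, IsTournament T ∧ IsStronglyConnected T := by
  classical
  have := Fintype.ofFinite V
  -- In a minimal complete strongly connected subgraph no double edge survives, as one direction
  -- could be deleted.
  obtain ⟨T, hTG, hT⟩ := (Set.toFinite
    {H : Digraph V | IsCompleteDigraph H ∧ IsStronglyConnected H}).exists_le_minimal
      (show G ∈ _ from ⟨hc, hG⟩)
  refine ⟨T, hTG, ⟨hT.prop.1.1, fun u v huv => ?_⟩, hT.prop.2⟩
  have key : ∀ u v, T.Adj u v → T.Adj v u → ¬ IsStronglyConnected (deleteEdge T u v) := by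
    intro u v huv hvu hs
    have hle : T ≤ deleteEdge T u v := hT.le_of_le
      (show deleteEdge T u v ∈ _ from ⟨isCompleteDigraph_deleteEdge hT.prop.1 hvu, hs⟩)
      fun _ _ h => h.1
    exact (hle huv).2 ⟨rfl, rfl⟩
  obtain ⟨w, hwu, hwv⟩ := hV u v
  rcases hT.prop.1.2 u v huv with h | h
  · refine Or.inl ⟨h, fun h' => ?_⟩
    rcases isStronglyConnected_deleteEdge_or hT.prop.1 hT.prop.2 hwu hwv with hs | hs
    · exact key u v h h' hs
    · exact key v u h' h hs
  · refine Or.inr ⟨h, fun h' => ?_⟩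
    rcases isStronglyConnected_deleteEdge_or hT.prop.1 hT.prop.2 hwu hwv with hs | hs
    · exact key u v h' h hs
    · exact key v u h h' hs

/-- Strongly connected tournaments if `k ≠ 2`, and the double edge if `k = 2`. -/
def IsSparse {k : ℕ} (G : Digraph (Fin k)) : Prop :=
  IsCompleteDigraph G ∧ IsStronglyConnected G ∧ (k ≠ 2 → IsTournament G)

theorem adj_iff_ne_of_isStronglyConnected_two {G : Digraph (Fin 2)} (hc : IsCompleteDigraph G)
    (hG : IsStronglyConnected G) (x y : Fin 2) : G.Adj x y ↔ x ≠ y := by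
  refine ⟨fun h hxy => hc.1 x (hxy ▸ h), fun hxy => ?_⟩
  rcases (hG x y).cases_head with h | ⟨z, hz, -⟩
  · exact absurd h hxy
  · have hzx : z ≠ x := fun h => hc.1 x (h ▸ hz)
    have : z = y := by omega
    rwa [← this]

theorem eq_of_isStronglyConnected_two {G H : Digraph (Fin 2)} (hc : IsCompleteDigraph G)
    (hG : IsStronglyConnected G) (hc' : IsCompleteDigraph H) (hH : IsStronglyConnected H) :
    G = H := by
  ext x y
  rw [adj_iff_ne_of_isStronglyConnected_two hc hG, adj_iff_ne_of_isStronglyConnected_two hc' hH]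

theorem exists_isSparse_le {k : ℕ} (hk : 2 ≤ k) {G : Digraph (Fin k)} (hc : IsCompleteDigraph G)
    (hG : IsStronglyConnected G) : ∃ T ≤ G, IsSparse T := by
  by_cases h2 : k = 2
  · exact ⟨G, le_rfl, hc, hG, fun h => absurd h2 h⟩
  · obtain ⟨T, hTG, hT, hs⟩ := exists_isTournament_le (fun u v => by
      by_contra! hcon
      have h1 : (Finset.univ : Finset (Fin k)) ⊆ {u, v} := fun w _ => by
        by_cases h : w = u
        · simp [h]
        · simp [hcon w h]
      have h3 := (Finset.card_le_card h1).trans Finset.card_le_two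
      rw [Finset.card_univ, Fintype.card_fin] at h3
      omega) hc hG
    exact ⟨T, hTG, ⟨hT.1, fun u v huv => (hT.2 u v huv).imp And.left And.left⟩, hs, fun _ => hT⟩

theorem ncard_isSparse (k : ℕ) : {G : Digraph (Fin k) | IsSparse G}.ncard = sigma k := by
  by_cases h2 : k = 2
  · subst h2
    rw [sigma, if_pos rfl, Set.ncard_eq_one]
    have hc : IsCompleteDigraph (⟨fun x y => x ≠ y⟩ : Digraph (Fin 2)) :=
      ⟨fun v h => h rfl, fun u v h => Or.inl h⟩
    have hs : IsStronglyConnected (⟨fun x y => x ≠ y⟩ : Digraph (Fin 2)) := fun u v => by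
      by_cases h : u = v
      · rw [h]
      · exact Relation.ReflTransGen.single h
    refine ⟨_, Set.eq_singleton_iff_unique_mem.2 ⟨⟨hc, hs, fun h => absurd rfl h⟩, fun G hG => ?_⟩⟩
    exact eq_of_isStronglyConnected_two hG.1 hG.2.1 hc hs
  · rw [sigma, if_neg h2, w]
    congr 1
    ext G
    refine ⟨fun h => ⟨h.2.2 h2, h.2.1⟩, fun h => ⟨⟨h.1.1, fun u v huv => ?_⟩, h.2, fun _ => h.1⟩⟩
    exact (h.1.2 u v huv).imp And.left And.left

end Digraphs

/-! ### Idempotent generating sets of `𝓔_k` -/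

section FullTransformations

variable {k : ℕ}

/-- `f` as a transformation of a set partitioned into singletons. -/
def withPoint : Function.End (Fin k) →* Function.End (Fin k × Fin 1) where
  toFun f := fun p => (f p.1, p.2)
  map_one' := rfl
  map_mul' _ _ := rfl

theorem withPoint_injective : Function.Injective (withPoint (k := k)) := fun _ _ h =>
  end_ext fun x => congrArg Prod.fst (congrFun h (x, 0))

theorem withPoint_e (i j : Fin k) (f : Equiv.Perm (Fin 1)) :
    withPoint (e i j) = eTwist i j f := by
  refine end_ext fun p => Prod.ext rfl (Subsingleton.elim _ _)

theorem withPoint_mem_idempotents_iff {f : Function.End (Fin k)} :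
    withPoint f ∈ idempotents (EXP k 1) ↔ f ∈ idempotents (E k) := by
  rw [idempotents_EXP]
  refine ⟨fun h => ?_, fun h => ⟨?_, h.2.map withPoint⟩⟩
  · have : IsIdempotentElem f := withPoint_injective ((withPoint.map_mul f f).trans h.2)
    exact ⟨Submonoid.subset_closure ⟨trivial, this⟩, this⟩
  · exact mem_TXP_iff.2 fun i => ⟨f i, fun p hp => by rw [← hp]; rfl⟩

/-- Every map preserves a partition into singletons, so results on `EXP` with blocks of size one
apply to `E k`. -/
theorem map_withPoint_E : (E k).map withPoint = EXP k 1 := by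
  rw [E, EXP, idempotentGenerated, idempotentGenerated, MonoidHom.map_mclosure]
  congr 1
  ext F
  constructor
  · rintro ⟨f, hf, rfl⟩
    rw [← idempotents_EXP, withPoint_mem_idempotents_iff]
    exact ⟨Submonoid.subset_closure hf, hf.2⟩
  · intro hF
    let f : Function.End (Fin k) := fun x => (F (x, 0)).1
    have hf : withPoint f = F := end_ext fun p => by
      obtain ⟨x, y⟩ := p
      obtain rfl : y = 0 := Subsingleton.elim _ _
      exact Prod.ext rfl (Subsingleton.elim _ _)
    refine ⟨f, ⟨trivial, ?_⟩, hf⟩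
    rw [← hf, ← idempotents_EXP] at hF
    exact (withPoint_mem_idempotents_iff.1 hF).2

theorem isIdempotentGeneratingSet_image_withPoint_iff {U : Set (Function.End (Fin k))} :
    IsIdempotentGeneratingSet (EXP k 1) (withPoint '' U) ↔ IsIdempotentGeneratingSet (E k) U := by
  refine and_congr ?_ ?_
  · rw [Set.image_subset_iff]
    exact forall₂_congr fun f _ => withPoint_mem_idempotents_iff
  · rw [← MonoidHom.map_mclosure, ← map_withPoint_E]
    exact (Submonoid.map_injective_of_injective withPoint_injective).eq_iff

/-- The digraph with an edge from `j` to `i` whenever `e_{ij}` belongs to `U`. -/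
def moveGraph (U : Set (Function.End (Fin k))) : Digraph (Fin k) :=
  ⟨fun j i => i ≠ j ∧ e i j ∈ U⟩

theorem eTwist_mem_image_withPoint_iff {U : Set (Function.End (Fin k))} {i j : Fin k}
    {f : Equiv.Perm (Fin 1)} : eTwist i j f ∈ withPoint '' U ↔ e i j ∈ U := by
  rw [← withPoint_e, withPoint_injective.mem_set_image]

theorem moves_image_withPoint (U : Set (Function.End (Fin k))) :
    Moves (withPoint '' U) = (moveGraph U).Adj := by
  funext j i
  refine propext (and_congr_right fun _ => ?_)
  simp only [eTwist_mem_image_withPoint_iff, exists_const]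

/-- The criterion for `EXP k 1`: with only the trivial permutation, the choice between the two
twists becomes completeness of the digraph, and the condition inside blocks is void. -/
theorem isIdempotentGeneratingSet_E_iff {U : Set (Function.End (Fin k))} :
    IsIdempotentGeneratingSet (E k) U ↔
      U ⊆ idempotents (E k) ∧ IsCompleteDigraph (moveGraph U) ∧
        IsStronglyConnected (moveGraph U) := by
  constructor
  · intro h
    have h' := isIdempotentGeneratingSet_image_withPoint_iff.2 h
    refine ⟨h.1, ⟨fun v hv => hv.1 rfl, fun u v huv => ?_⟩, fun u v => ?_⟩
    · have := h'.eTwist_mem_or one_pos huv.symm 1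
      rw [eTwist_mem_image_withPoint_iff, eTwist_mem_image_withPoint_iff] at this
      exact this.imp (fun h => ⟨huv.symm, h⟩) fun h => ⟨huv, h⟩
    · have := h'.reflTransGen_moves one_pos u v
      rwa [moves_image_withPoint] at this
  · rintro ⟨hU, hc, hs⟩
    refine isIdempotentGeneratingSet_image_withPoint_iff.1 (isIdempotentGeneratingSet_of_moves ?_
      (fun i => ⟨∅, ?_, by simp⟩) (fun i j f hij => ?_) fun i j => ?_)
    · rw [Set.image_subset_iff]
      exact fun f hf => withPoint_mem_idempotents_iff.2 (hU hf)
    · refine le_antisymm (Submonoid.closure_le.2 (Set.empty_subset _)) fun f _ => ?_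
      have : f = 1 := end_ext fun x => Subsingleton.elim _ _
      rw [this]
      exact one_mem _
    · rw [eTwist_mem_image_withPoint_iff, eTwist_mem_image_withPoint_iff]
      exact (hc.2 j i hij.symm).imp And.right And.right
    · rw [moves_image_withPoint]
      exact hs i j

/-- The set of all `e_{ij}` such that `G` has an edge from `j` to `i`. -/
def elementarySet (G : Digraph (Fin k)) : Set (Function.End (Fin k)) :=
  {f | ∃ i j, G.Adj j i ∧ e i j = f}

theorem e_mem_elementarySet_iff {G : Digraph (Fin k)} {i j : Fin k} (hij : i ≠ j) :
    e i j ∈ elementarySet G ↔ G.Adj j i := by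
  refine ⟨?_, fun h => ⟨i, j, h, rfl⟩⟩
  rintro ⟨i', j', h, he⟩
  obtain ⟨rfl, rfl⟩ := e_inj hij he.symm
  exact h

theorem moveGraph_elementarySet {G : Digraph (Fin k)} (hG : ∀ v, ¬ G.Adj v v) :
    moveGraph (elementarySet G) = G := by
  ext j i
  refine ⟨fun h => (e_mem_elementarySet_iff h.1).1 h.2, fun h => ?_⟩
  have hij : i ≠ j := fun h' => hG j (by rwa [h'] at h)
  exact ⟨hij, i, j, h, rfl⟩

theorem elementarySet_subset_idempotents {G : Digraph (Fin k)} (hG : ∀ v, ¬ G.Adj v v) :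
    elementarySet G ⊆ idempotents (E k) := by
  rintro _ ⟨i, j, h, rfl⟩
  have := e_isIdempotentElem (i := i) (j := j) fun h' => hG j (by rwa [h'] at h)
  exact ⟨Submonoid.subset_closure ⟨trivial, this⟩, this⟩

theorem isIdempotentGeneratingSet_elementarySet {G : Digraph (Fin k)} (hc : IsCompleteDigraph G)
    (hs : IsStronglyConnected G) : IsIdempotentGeneratingSet (E k) (elementarySet G) := by
  rw [isIdempotentGeneratingSet_E_iff, moveGraph_elementarySet hc.1]
  exact ⟨elementarySet_subset_idempotents hc.1, hc, hs⟩

theorem elementarySet_encard_of_isTournament {G : Digraph (Fin k)} (hG : IsTournament G) :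
    (elementarySet G).encard = ENat.card {p : Fin k × Fin k // p.1 < p.2} := by
  classical
  let F : {p : Fin k × Fin k // p.1 < p.2} → Function.End (Fin k) := fun p =>
    if G.Adj p.1.2 p.1.1 then e p.1.1 p.1.2 else e p.1.2 p.1.1
  have hF : Function.Injective F := by
    rintro ⟨⟨i, j⟩, hij⟩ ⟨⟨i', j'⟩, hij'⟩ h
    dsimp only at hij hij'
    simp only [F] at h
    split_ifs at h
    · obtain ⟨rfl, rfl⟩ := e_inj hij.ne h
      rfl
    · obtain ⟨rfl, rfl⟩ := e_inj hij.ne h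
      exact absurd hij hij'.asymm
    · obtain ⟨rfl, rfl⟩ := e_inj hij.ne' h
      exact absurd hij hij'.asymm
    · obtain ⟨rfl, rfl⟩ := e_inj hij.ne' h
      rfl
  have hrange : elementarySet G = Set.range F := by
    ext f
    constructor
    · rintro ⟨i, j, h, rfl⟩
      rcases lt_trichotomy i j with hij | rfl | hij
      · exact ⟨⟨(i, j), hij⟩, if_pos h⟩
      · exact absurd h (hG.1 i)
      · refine ⟨⟨(j, i), hij⟩, if_neg fun h' => ?_⟩
        rcases hG.2 i j hij.ne' with h'' | h''
        · exact h''.2 h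
        · exact h''.2 h'
    · rintro ⟨⟨⟨i, j⟩, hij⟩, rfl⟩
      dsimp only at hij
      simp only [F]
      split_ifs with h
      · exact ⟨i, j, h, rfl⟩
      · refine ⟨j, i, ?_, rfl⟩
        rcases hG.2 i j hij.ne with h' | h'
        · exact h'.1
        · exact absurd h'.1 h
  rw [hrange, ← Set.image_univ, hF.encard_image, Set.encard_univ]

theorem elementarySet_encard_eq {G H : Digraph (Fin k)} (hG : IsSparse G) (hH : IsSparse H) :
    (elementarySet G).encard = (elementarySet H).encard := by
  by_cases h2 : k = 2
  · subst h2
    rw [eq_of_isStronglyConnected_two hG.1 hG.2.1 hH.1 hH.2.1]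
  · rw [elementarySet_encard_of_isTournament (hG.2.2 h2),
      elementarySet_encard_of_isTournament (hH.2.2 h2)]

/-- A criterion for minimality by cardinality to coincide with minimality by inclusion. -/
theorem minimal_iff_of_encard_eq {α : Type*} [Finite α] {P C : Set α → Prop}
    (hCP : ∀ W, C W → P W) (hex : ∀ U, P U → ∃ W ⊆ U, C W)
    (hcard : ∀ W W', C W → C W' → W.encard = W'.encard) (W : Set α) :
    ((P W ∧ ∀ U, P U → W.encard ≤ U.encard) ↔ C W) ∧ (Minimal P W ↔ C W) := by
  refine ⟨⟨fun h => ?_, fun h => ⟨hCP W h, fun U hU => ?_⟩⟩, ⟨fun h => ?_, fun h =>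
    ⟨hCP W h, fun U hU hUW => ?_⟩⟩⟩
  · obtain ⟨W', hsub, hW'⟩ := hex W h.1
    rwa [← (Set.toFinite W').eq_of_subset_of_encard_le hsub (h.2 W' (hCP W' hW'))]
  · obtain ⟨W', hsub, hW'⟩ := hex U hU
    rw [hcard W W' h hW']
    exact Set.encard_le_encard hsub
  · obtain ⟨W', hsub, hW'⟩ := hex W h.prop
    rwa [h.eq_of_ge (hCP W' hW') hsub]
  · obtain ⟨W', hsub, hW'⟩ := hex U hU
    have := (Set.toFinite W').eq_of_subset_of_encard_le (hsub.trans hUW) (hcard W W' h hW').le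
    exact this ▸ hsub

instance : Finite (Function.End (Fin k)) := inferInstanceAs (Finite (Fin k → Fin k))

theorem exists_isSparse_elementarySet_subset (hk : 2 ≤ k) {U : Set (Function.End (Fin k))}
    (hU : IsIdempotentGeneratingSet (E k) U) :
    ∃ W ⊆ U, ∃ G, IsSparse G ∧ W = elementarySet G := by
  obtain ⟨-, hc, hs⟩ := isIdempotentGeneratingSet_E_iff.1 hU
  obtain ⟨T, hTG, hT⟩ := exists_isSparse_le hk hc hs
  refine ⟨elementarySet T, ?_, T, hT, rfl⟩
  rintro _ ⟨i, j, h, rfl⟩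
  exact (hTG h).2

theorem isMinimalIdempotentGeneratingSet_E_iff (hk : 2 ≤ k) {W : Set (Function.End (Fin k))} :
    IsMinimalIdempotentGeneratingSet (E k) W ↔ ∃ G, IsSparse G ∧ W = elementarySet G := by
  refine (minimal_iff_of_encard_eq (P := IsIdempotentGeneratingSet (E k))
    (C := fun W => ∃ G, IsSparse G ∧ W = elementarySet G) ?_
    (fun U hU => exists_isSparse_elementarySet_subset hk hU) ?_ W).1
  · rintro _ ⟨G, hG, rfl⟩
    exact isIdempotentGeneratingSet_elementarySet hG.1 hG.2.1
  · rintro _ _ ⟨G, hG, rfl⟩ ⟨H, hH, rfl⟩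
    exact elementarySet_encard_eq hG hH

theorem ncard_isMinimalIdempotentGeneratingSet_E (hk : 2 ≤ k) :
    {W | IsMinimalIdempotentGeneratingSet (E k) W}.ncard = sigma k := by
  have : {W | IsMinimalIdempotentGeneratingSet (E k) W} =
      elementarySet '' {G : Digraph (Fin k) | IsSparse G} := by
    ext W
    rw [Set.mem_ofPred_eq, isMinimalIdempotentGeneratingSet_E_iff hk]
    exact ⟨fun ⟨G, hG, h⟩ => ⟨G, hG, h.symm⟩, fun ⟨G, hG, h⟩ => ⟨G, hG, h.symm⟩⟩
  rw [this, Set.InjOn.ncard_image, ncard_isSparse]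
  intro G hG H hH h
  rw [← moveGraph_elementarySet hG.1.1, ← moveGraph_elementarySet hH.1.1]
  exact congrArg moveGraph h

/-- The generated monoid is `E k`, which contains all singular maps. As a singular map is not `1`,
it is already a non-empty product. -/
theorem closure_elementarySet_eq_singular {G : Digraph (Fin k)} (hc : IsCompleteDigraph G)
    (hs : IsStronglyConnected G) :
    (Subsemigroup.closure (elementarySet G) : Set (Function.End (Fin k))) = singular k := by
  have hne : ∀ i j, G.Adj j i → i ≠ j := fun i j h h' => hc.1 j (by rwa [h'] at h)
  refine Set.Subset.antisymm ?_ fun f hf => ?_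
  · intro f hf
    have : ¬ Function.Injective (f : Fin k → Fin k) := by
      induction hf using Subsemigroup.closure_induction with
      | mem f hf =>
        obtain ⟨i, j, h, rfl⟩ := hf
        exact e_not_injective (hne i j h)
      | mul f g _ _ _ hg => exact fun h => hg (Function.Injective.of_comp (f := f) h)
    exact fun h => this h.1
  · have hmem : f ∈ (Submonoid.closure (elementarySet G) : Set _) := by
      rw [(isIdempotentGeneratingSet_elementarySet hc hs).2]
      exact singular_subset_E k hf
    rw [Submonoid.closure_eq_one_union] at hmem
    rcases hmem with h | h
    · rw [Set.mem_singleton_iff] at h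
      subst h
      exact absurd Function.bijective_id hf
    · exact h

theorem elementarySet_subset_defectOneIdempotents {G : Digraph (Fin k)}
    (hG : ∀ v, ¬ G.Adj v v) : elementarySet G ⊆ defectOneIdempotents k := by
  rintro _ ⟨i, j, h, rfl⟩
  have hij : i ≠ j := fun h' => hG j (by rwa [h'] at h)
  refine ⟨e_isIdempotentElem hij, ?_⟩
  have : Set.range (e i j : Fin k → Fin k) = {j}ᶜ := by
    ext x
    constructor
    · rintro ⟨y, rfl⟩
      by_cases hy : y = j
      · rw [hy, e_apply_self]
        exact hij
      · rw [e_apply_of_ne hy]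
        exact hy
    · exact fun hx => ⟨x, e_apply_of_ne hx⟩
  rw [this, Set.ncard_compl, Set.ncard_singleton, Nat.card_eq_fintype_card, Fintype.card_fin]
  have := j.pos
  omega

end FullTransformations

/-! ### Choosing one of `e_{ij;f}` and `e_{ji;f⁻¹}` -/

section Choice

variable {m n : ℕ}

/-- The pairs `(i, j)` with `i < j`. -/
abbrev OrderedPair (m : ℕ) := {p : Fin m × Fin m // p.1 < p.2}

/-- The element chosen from `{e_{ij;f}, e_{ji;f⁻¹}}`: the former if and only if `f ∈ a_{ij}`. -/
noncomputable def choiceMap (a : OrderedPair m → Finset (Equiv.Perm (Fin n)))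
    (x : OrderedPair m × Equiv.Perm (Fin n)) : Function.End (Fin m × Fin n) :=
  if x.2 ∈ a x.1 then eTwist x.1.1.1 x.1.1.2 x.2 else eTwist x.1.1.2 x.1.1.1 x.2⁻¹

/-- The set of all chosen elements. -/
def choiceSet (a : OrderedPair m → Finset (Equiv.Perm (Fin n))) :
    Set (Function.End (Fin m × Fin n)) := Set.range (choiceMap a)

/-- The digraph with an edge from `j` to `i` whenever some `e_{ij;f}` is chosen. -/
def choiceGraph (a : OrderedPair m → Finset (Equiv.Perm (Fin n))) : Digraph (Fin m) :=
  ⟨Moves (choiceSet a)⟩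

theorem choiceMap_injective (hn : 0 < n) (a : OrderedPair m → Finset (Equiv.Perm (Fin n))) :
    Function.Injective (choiceMap a) := by
  rintro ⟨⟨⟨i, j⟩, hij⟩, f⟩ ⟨⟨⟨i', j'⟩, hij'⟩, f'⟩ h
  dsimp only at hij hij'
  simp only [choiceMap] at h
  split_ifs at h
  · obtain ⟨rfl, rfl, rfl⟩ := eTwist_inj hn hij.ne h
    rfl
  · obtain ⟨rfl, rfl, -⟩ := eTwist_inj hn hij.ne h
    exact absurd hij hij'.asymm
  · obtain ⟨rfl, rfl, -⟩ := eTwist_inj hn hij.ne' h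
    exact absurd hij hij'.asymm
  · obtain ⟨rfl, rfl, hf⟩ := eTwist_inj hn hij.ne' h
    rw [inv_inj.1 hf]

theorem choiceSet_encard (hn : 0 < n) (a : OrderedPair m → Finset (Equiv.Perm (Fin n))) :
    (choiceSet a).encard = ENat.card (OrderedPair m × Equiv.Perm (Fin n)) := by
  rw [choiceSet, ← Set.image_univ, (choiceMap_injective hn a).encard_image, Set.encard_univ]

theorem eTwist_mem_choiceSet_iff (hn : 0 < n) {a : OrderedPair m → Finset (Equiv.Perm (Fin n))}
    (p : OrderedPair m) (f : Equiv.Perm (Fin n)) :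
    eTwist p.1.1 p.1.2 f ∈ choiceSet a ↔ f ∈ a p := by
  obtain ⟨⟨i, j⟩, hij⟩ := p
  dsimp only at hij
  refine ⟨?_, fun h => ⟨(⟨(i, j), hij⟩, f), if_pos h⟩⟩
  rintro ⟨⟨⟨⟨i', j'⟩, hij'⟩, f'⟩, h⟩
  dsimp only at hij'
  simp only [choiceMap] at h
  split_ifs at h with hf
  · obtain ⟨rfl, rfl, rfl⟩ := eTwist_inj hn hij'.ne h
    exact hf
  · obtain ⟨rfl, rfl, -⟩ := eTwist_inj hn hij'.ne' h
    exact absurd hij hij'.asymm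

theorem eTwist_swap_mem_choiceSet_iff (hn : 0 < n)
    {a : OrderedPair m → Finset (Equiv.Perm (Fin n))} (p : OrderedPair m)
    (f : Equiv.Perm (Fin n)) : eTwist p.1.2 p.1.1 f⁻¹ ∈ choiceSet a ↔ f ∉ a p := by
  obtain ⟨⟨i, j⟩, hij⟩ := p
  dsimp only at hij
  refine ⟨?_, fun h => ⟨(⟨(i, j), hij⟩, f), if_neg h⟩⟩
  rintro ⟨⟨⟨⟨i', j'⟩, hij'⟩, f'⟩, h⟩
  dsimp only at hij'
  simp only [choiceMap] at h
  split_ifs at h with hf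
  · obtain ⟨rfl, rfl, -⟩ := eTwist_inj hn hij'.ne h
    exact absurd hij hij'.asymm
  · obtain ⟨rfl, rfl, hff⟩ := eTwist_inj hn hij'.ne' h
    rwa [← inv_inj.1 hff]

theorem choiceSet_subset_twists (a : OrderedPair m → Finset (Equiv.Perm (Fin n))) :
    choiceSet a ⊆ twists m n := by
  rintro _ ⟨⟨⟨⟨i, j⟩, hij⟩, f⟩, rfl⟩
  dsimp only at hij
  simp only [choiceMap]
  split_ifs
  · exact ⟨i, j, f, hij.ne, rfl⟩
  · exact ⟨j, i, f⁻¹, hij.ne', rfl⟩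

theorem eTwist_mem_choiceSet_or (hn : 0 < n) (a : OrderedPair m → Finset (Equiv.Perm (Fin n)))
    {i j : Fin m} (hij : i ≠ j) (f : Equiv.Perm (Fin n)) :
    eTwist i j f ∈ choiceSet a ∨ eTwist j i f⁻¹ ∈ choiceSet a := by
  rcases lt_or_gt_of_ne hij with h | h
  · rw [eTwist_mem_choiceSet_iff hn ⟨(i, j), h⟩, eTwist_swap_mem_choiceSet_iff hn ⟨(i, j), h⟩]
    exact em _
  · have h1 := eTwist_mem_choiceSet_iff hn (a := a) ⟨(j, i), h⟩ f⁻¹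
    have h2 := eTwist_swap_mem_choiceSet_iff hn (a := a) ⟨(j, i), h⟩ f⁻¹
    rw [inv_inv] at h2
    rw [h1, h2]
    exact (em _).symm

theorem choiceSet_injective (hn : 0 < n) :
    Function.Injective
      (choiceSet : (OrderedPair m → Finset (Equiv.Perm (Fin n))) → Set _) := by
  intro a b h
  ext p f
  rw [← eTwist_mem_choiceSet_iff hn, ← eTwist_mem_choiceSet_iff hn, h]

theorem choiceGraph_adj_snd_fst_iff (hn : 0 < n)
    {a : OrderedPair m → Finset (Equiv.Perm (Fin n))} (p : OrderedPair m) :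
    (choiceGraph a).Adj p.1.2 p.1.1 ↔ (a p).Nonempty := by
  refine ⟨fun h => ?_, fun ⟨f, hf⟩ => ⟨p.2.ne, f, (eTwist_mem_choiceSet_iff hn p f).2 hf⟩⟩
  obtain ⟨-, f, hf⟩ := h
  exact ⟨f, (eTwist_mem_choiceSet_iff hn p f).1 hf⟩

theorem choiceGraph_adj_fst_snd_iff (hn : 0 < n)
    {a : OrderedPair m → Finset (Equiv.Perm (Fin n))} (p : OrderedPair m) :
    (choiceGraph a).Adj p.1.1 p.1.2 ↔ a p ≠ Finset.univ := by
  rw [Ne, Finset.eq_univ_iff_forall, not_forall]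
  refine ⟨fun h => ?_, fun ⟨f, hf⟩ =>
    ⟨p.2.ne', f⁻¹, (eTwist_swap_mem_choiceSet_iff hn p f).2 hf⟩⟩
  obtain ⟨-, f, hf⟩ := h
  rw [← inv_inv f, eTwist_swap_mem_choiceSet_iff hn p] at hf
  exact ⟨_, hf⟩

theorem isCompleteDigraph_choiceGraph (hn : 0 < n)
    (a : OrderedPair m → Finset (Equiv.Perm (Fin n))) : IsCompleteDigraph (choiceGraph a) :=
  ⟨fun _ h => h.1 rfl, fun _ _ h => (eTwist_mem_choiceSet_or hn a h 1).symm.imp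
    (fun h' => ⟨h.symm, _, h'⟩) fun h' => ⟨h, _, h'⟩⟩

/-- `s = A` works unless `A` is everything and `B` is non-empty; then one element of `B` is given
up, and a second element of `α` keeps `s` non-empty. -/
theorem exists_subset_compl_subset {α : Type*} [Fintype α] [DecidableEq α] [Nontrivial α]
    {A B : Finset α} (h : A ∪ B = Finset.univ) :
    ∃ s ⊆ A, sᶜ ⊆ B ∧ (A.Nonempty → s.Nonempty) ∧ (B.Nonempty → s ≠ Finset.univ) := by
  have hcompl : Aᶜ ⊆ B := fun x hx => by
    have := h ▸ Finset.mem_univ x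
    rw [Finset.mem_union] at this
    exact this.resolve_left (Finset.mem_compl.1 hx)
  by_cases hA : A = Finset.univ
  · rcases B.eq_empty_or_nonempty with rfl | ⟨b, hb⟩
    · exact ⟨A, Finset.Subset.rfl, hcompl, id, fun h => absurd h Finset.not_nonempty_empty⟩
    · refine ⟨{b}ᶜ, hA ▸ Finset.subset_univ _, by simpa using hb, fun _ => ?_, fun _ h => ?_⟩
      · obtain ⟨c, hc⟩ := exists_ne b
        exact ⟨c, by simpa using hc⟩
      · have := h ▸ Finset.mem_univ b
        simp at this
  · exact ⟨A, Finset.Subset.rfl, hcompl, id, fun _ => hA⟩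

/-- The choice is made separately for each pair of blocks so that every direction present in `U`
stays present. Strong connectivity is inherited because no edge disappears. -/
theorem exists_choiceSet_subset (hn : 2 ≤ n) {U : Set (Function.End (Fin m × Fin n))}
    (hU : IsIdempotentGeneratingSet (EXP m n) U) :
    ∃ a : OrderedPair m → Finset (Equiv.Perm (Fin n)),
      choiceSet a ⊆ U ∧ IsStronglyConnected (choiceGraph a) := by
  classical
  have hn0 : 0 < n := by omega
  have : Nontrivial (Fin n) := Fin.nontrivial_iff_two_le.2 hn
  let A : OrderedPair m → Finset (Equiv.Perm (Fin n)) := fun p =>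
    Finset.univ.filter fun f => eTwist p.1.1 p.1.2 f ∈ U
  let B : OrderedPair m → Finset (Equiv.Perm (Fin n)) := fun p =>
    Finset.univ.filter fun f => eTwist p.1.2 p.1.1 f⁻¹ ∈ U
  have hAB : ∀ p, A p ∪ B p = Finset.univ := fun p => by
    ext f
    simpa [A, B] using hU.eTwist_mem_or hn0 p.2.ne f
  choose a haA haB hA hB using fun p => exists_subset_compl_subset (hAB p)
  refine ⟨a, ?_, IsStronglyConnected.of_reflTransGen (G := ⟨Moves U⟩)
    (hU.reflTransGen_moves hn0) ?_⟩
  · rintro _ ⟨⟨p, f⟩, rfl⟩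
    simp only [choiceMap]
    split_ifs with h
    · exact (Finset.mem_filter.1 (haA p h)).2
    · exact (Finset.mem_filter.1 (haB p (Finset.mem_compl.2 h))).2
  · rintro j i ⟨hij, f, hf⟩
    refine Relation.ReflTransGen.single ?_
    rcases lt_or_gt_of_ne hij with h | h
    · exact (choiceGraph_adj_snd_fst_iff hn0 ⟨(i, j), h⟩).2
        (hA ⟨(i, j), h⟩ ⟨f, by simpa [A] using hf⟩)
    · exact (choiceGraph_adj_fst_snd_iff hn0 ⟨(j, i), h⟩).2
        (hB ⟨(j, i), h⟩ ⟨f⁻¹, by simpa [B] using hf⟩)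

/-! ### Minimal idempotent generating sets of `𝓔(X,𝓟)` -/

/-- `U_1^{(1)} ∪ ⋯ ∪ U_m^{(m)}` together with the elements chosen by `a`. -/
def standardSet (U : Fin m → Set (Function.End (Fin n)))
    (a : OrderedPair m → Finset (Equiv.Perm (Fin n))) : Set (Function.End (Fin m × Fin n)) :=
  (⋃ i, inBlock i '' U i) ∪ choiceSet a

/-- The sets that turn out to be the minimal idempotent generating sets of `𝓔(X,𝓟)`. -/
def IsStandard (W : Set (Function.End (Fin m × Fin n))) : Prop :=
  ∃ (U : Fin m → Set (Function.End (Fin n))) (a : OrderedPair m → Finset (Equiv.Perm (Fin n))),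
    (∀ i, IsMinimalIdempotentGeneratingSet (E n) (U i)) ∧ IsStronglyConnected (choiceGraph a) ∧
      W = standardSet U a

theorem inBlock_notMem_twists (hn : 0 < n) (i : Fin m) (g : Function.End (Fin n)) :
    inBlock i g ∉ twists m n := by
  rintro ⟨a, b, f, hab, h⟩
  have := congrFun h (b, ⟨0, hn⟩)
  rw [eTwist_apply_self, inBlock_apply] at this
  exact hab (congrArg Prod.fst this)

theorem eTwist_mem_standardSet_iff (hn : 0 < n) {U : Fin m → Set (Function.End (Fin n))}
    {a : OrderedPair m → Finset (Equiv.Perm (Fin n))} {i j : Fin m} (hij : i ≠ j)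
    (f : Equiv.Perm (Fin n)) : eTwist i j f ∈ standardSet U a ↔ eTwist i j f ∈ choiceSet a := by
  refine ⟨fun h => h.resolve_left fun h' => ?_, Or.inr⟩
  obtain ⟨k, g, -, hg⟩ := Set.mem_iUnion.1 h'
  exact inBlock_notMem_twists hn k g ⟨i, j, f, hij, hg.symm⟩

/-- The left side fixes block `k` pointwise. Since minimal sets omit `1`, the parts belonging to
different blocks are disjoint. -/
theorem eq_one_of_inBlock_eq_inBlock {i k : Fin m} (hik : i ≠ k) {g h : Function.End (Fin n)}
    (hgh : inBlock i g = inBlock k h) : h = 1 := by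
  refine end_ext fun x => ?_
  have := congrFun hgh (k, x)
  rw [inBlock_apply_self, inBlock_apply_of_ne (Ne.symm hik)] at this
  exact (congrArg Prod.snd this).symm

theorem one_notMem_of_isMinimal (hn : 2 ≤ n) {U : Set (Function.End (Fin n))}
    (hU : IsMinimalIdempotentGeneratingSet (E n) U) : 1 ∉ U := by
  obtain ⟨G, hG, rfl⟩ := (isMinimalIdempotentGeneratingSet_E_iff hn).1 hU
  rintro ⟨i, j, h, he⟩
  exact e_ne_one (fun h' => hG.1.1 j (by rwa [h'] at h)) he

theorem inBlock_preimage_standardSet (hn : 2 ≤ n) {U : Fin m → Set (Function.End (Fin n))}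
    (hU : ∀ i, IsMinimalIdempotentGeneratingSet (E n) (U i))
    (a : OrderedPair m → Finset (Equiv.Perm (Fin n))) (i : Fin m) :
    inBlock i ⁻¹' standardSet U a = U i := by
  ext g
  refine ⟨fun h => ?_, fun h => Or.inl (Set.mem_iUnion.2 ⟨i, g, h, rfl⟩)⟩
  rcases h with h | h
  · obtain ⟨k, g', hg', he⟩ := Set.mem_iUnion.1 h
    by_cases hik : i = k
    · subst hik
      rwa [← inBlock_injective i he]
    · rw [eq_one_of_inBlock_eq_inBlock hik he.symm] at hg'
      exact absurd hg' (one_notMem_of_isMinimal hn (hU k))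
  · exact absurd (choiceSet_subset_twists a h) (inBlock_notMem_twists (by omega) i g)

theorem isIdempotentGeneratingSet_of_isStandard (hn : 2 ≤ n)
    {W : Set (Function.End (Fin m × Fin n))} (hW : IsStandard W) :
    IsIdempotentGeneratingSet (EXP m n) W := by
  have hn0 : 0 < n := by omega
  obtain ⟨U, a, hU, hs, rfl⟩ := hW
  refine isIdempotentGeneratingSet_of_moves ?_ (fun i => ⟨U i, (hU i).1.2, ?_⟩)
    (fun i j f hij => ?_) fun i j => ?_
  · rintro _ (h | h)
    · obtain ⟨i, g, hg, rfl⟩ := Set.mem_iUnion.1 h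
      exact inBlock_mem_idempotents i ((hU i).1.1 hg).2
    · obtain ⟨i, j, f, hij, rfl⟩ := choiceSet_subset_twists a h
      exact eTwist_mem_idempotents hij f
  · exact fun x hx => Or.inl (Set.mem_iUnion.2 ⟨i, hx⟩)
  · exact (eTwist_mem_choiceSet_or hn0 a hij f).imp Or.inr Or.inr
  · have hle : (choiceGraph a).Adj ≤ Moves (standardSet U a) :=
      fun _ _ h => ⟨h.1, h.2.imp fun _ => Or.inr⟩
    exact Relation.ReflTransGen.mono hle i j (hs i j)

theorem exists_isStandard_subset (hn : 2 ≤ n) {U : Set (Function.End (Fin m × Fin n))}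
    (hU : IsIdempotentGeneratingSet (EXP m n) U) : ∃ W ⊆ U, IsStandard W := by
  obtain ⟨a, haU, ha⟩ := exists_choiceSet_subset hn hU
  choose U' hU'sub hU' using fun i =>
    exists_isSparse_elementarySet_subset hn (closure_preimage_inBlock hU i)
  refine ⟨standardSet U' a, Set.union_subset (Set.iUnion_subset fun i => ?_) haU, U', a,
    fun i => (isMinimalIdempotentGeneratingSet_E_iff hn).2 (hU' i), ha, rfl⟩
  exact Set.image_subset_iff.2 (hU'sub i)

theorem standardSet_encard (hn : 2 ≤ n) {U : Fin m → Set (Function.End (Fin n))}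
    (hU : ∀ i, IsMinimalIdempotentGeneratingSet (E n) (U i))
    (a : OrderedPair m → Finset (Equiv.Perm (Fin n))) :
    (standardSet U a).encard =
      ∑ᶠ i, (U i).encard + ENat.card (OrderedPair m × Equiv.Perm (Fin n)) := by
  have hn0 : 0 < n := by omega
  rw [standardSet, Set.encard_union_eq, choiceSet_encard hn0, Set.encard_iUnion_of_finite]
  · simp only [(inBlock_injective _).encard_image]
  · intro i k hik
    refine Set.disjoint_left.2 ?_
    rintro _ ⟨g, -, rfl⟩ ⟨g', hg', he⟩
    rw [eq_one_of_inBlock_eq_inBlock hik he.symm] at hg'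
    exact one_notMem_of_isMinimal hn (hU k) hg'
  · refine Set.disjoint_left.2 fun x hx hx' => ?_
    obtain ⟨i, g, -, rfl⟩ := Set.mem_iUnion.1 hx
    exact inBlock_notMem_twists hn0 i g (choiceSet_subset_twists a hx')

theorem encard_eq_of_isStandard (hn : 2 ≤ n) {W W' : Set (Function.End (Fin m × Fin n))}
    (hW : IsStandard W) (hW' : IsStandard W') : W.encard = W'.encard := by
  obtain ⟨U, a, hU, -, rfl⟩ := hW
  obtain ⟨U', a', hU', -, rfl⟩ := hW'
  rw [standardSet_encard hn hU, standardSet_encard hn hU']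
  congr 2
  funext i
  exact le_antisymm ((hU i).2 _ (hU' i).1) ((hU' i).2 _ (hU i).1)

theorem isMinimal_iff_isStandard (hn : 2 ≤ n) (W : Set (Function.End (Fin m × Fin n))) :
    (IsMinimalIdempotentGeneratingSet (EXP m n) W ↔ IsStandard W) ∧
      (Minimal (IsIdempotentGeneratingSet (EXP m n)) W ↔ IsStandard W) := by
  have : Finite (Function.End (Fin m × Fin n)) :=
    inferInstanceAs (Finite (Fin m × Fin n → Fin m × Fin n))
  exact minimal_iff_of_encard_eq (fun _ => isIdempotentGeneratingSet_of_isStandard hn)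
    (fun _ => exists_isStandard_subset hn) (fun _ _ => encard_eq_of_isStandard hn) W

/-! ### The standard form -/

/-- If no twist from `i` onto `j` is chosen, then all twists from `j` onto `i` are: this is the
`Phi` part. Pairs with both directions present form the `Xi` part, split by `a` and its complement.
-/
theorem choiceSet_eq_twistSet (hn : 0 < n) (a : OrderedPair m → Finset (Equiv.Perm (Fin n)))
    {A B : Fin m × Fin m → Set (Equiv.Perm (Fin n))} (hA : ∀ p : OrderedPair m, A p.1 = a p)
    (hB : ∀ p : OrderedPair m, B p.1 = (a p : Set (Equiv.Perm (Fin n)))ᶜ) :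
    twistSet (elementarySet (choiceGraph a)) A B = choiceSet a := by
  ext t
  constructor
  · rintro (ht | ht)
    · simp only [Set.mem_iUnion] at ht
      obtain ⟨⟨i, j⟩, ⟨hij, -, hji⟩, f, rfl⟩ := ht
      dsimp only at hij hji ⊢
      refine (eTwist_mem_choiceSet_or hn a hij f).resolve_right fun h => hji ?_
      exact (e_mem_elementarySet_iff hij.symm).2 ⟨hij.symm, _, h⟩
    · simp only [Set.mem_iUnion] at ht
      obtain ⟨p, ⟨hp, -, -⟩, ⟨f, hf, rfl⟩ | ⟨f, hf, rfl⟩⟩ := ht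
      · rw [hA ⟨p, hp⟩] at hf
        exact (eTwist_mem_choiceSet_iff hn ⟨p, hp⟩ f).2 hf
      · rw [hB ⟨p, hp⟩] at hf
        exact (eTwist_swap_mem_choiceSet_iff hn ⟨p, hp⟩ f).2 hf
  · intro ht
    obtain ⟨i, j, f, hij, rfl⟩ := choiceSet_subset_twists a ht
    have h1 : e i j ∈ elementarySet (choiceGraph a) :=
      (e_mem_elementarySet_iff hij).2 ⟨hij, f, ht⟩
    by_cases h2 : e j i ∈ elementarySet (choiceGraph a)
    · right
      simp only [Set.mem_iUnion]
      rcases lt_or_gt_of_ne hij with h | h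
      · refine ⟨(i, j), ⟨h, h1, h2⟩, Or.inl ⟨f, ?_, rfl⟩⟩
        rw [hA ⟨(i, j), h⟩]
        exact (eTwist_mem_choiceSet_iff hn ⟨(i, j), h⟩ f).1 ht
      · refine ⟨(j, i), ⟨h, h2, h1⟩, Or.inr ⟨f⁻¹, ?_, by simp only [inv_inv]⟩⟩
        rw [hB ⟨(j, i), h⟩]
        exact (eTwist_swap_mem_choiceSet_iff hn ⟨(j, i), h⟩ f⁻¹).1 (by rwa [inv_inv])
    · left
      simp only [Set.mem_iUnion]
      exact ⟨(i, j), ⟨hij, h1, h2⟩, f, rfl⟩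

theorem hasStandardForm_of_isStandard (hn : 2 ≤ n) {W : Set (Function.End (Fin m × Fin n))}
    (hW : IsStandard W) : HasStandardForm W := by
  classical
  have hn0 : 0 < n := by omega
  obtain ⟨U, a, hU, hs, rfl⟩ := hW
  have hc := isCompleteDigraph_choiceGraph hn0 a
  -- The default value is never consulted, as `Xi` contains only increasing pairs.
  let A : Fin m × Fin m → Set (Equiv.Perm (Fin n)) := fun p =>
    if h : p.1 < p.2 then a ⟨p, h⟩ else ∅
  have hA : ∀ p : OrderedPair m, A p.1 = a p := fun p => dif_pos p.2
  refine ⟨U, elementarySet (choiceGraph a), A, fun p => (A p)ᶜ, hU,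
    elementarySet_subset_defectOneIdempotents hc.1, closure_elementarySet_eq_singular hc hs, ?_, ?_⟩
  · rintro p ⟨hp, h1, h2⟩
    rw [e_mem_elementarySet_iff hp.ne] at h1
    rw [e_mem_elementarySet_iff hp.ne'] at h2
    refine ⟨?_, ?_, disjoint_compl_right, Set.union_compl_self _⟩
    · rw [hA ⟨p, hp⟩, Finset.coe_nonempty]
      exact (choiceGraph_adj_snd_fst_iff hn0 ⟨p, hp⟩).1 h1
    · show (A p)ᶜ.Nonempty
      rw [hA ⟨p, hp⟩, Set.nonempty_compl, Ne, Finset.coe_eq_univ]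
      exact (choiceGraph_adj_fst_snd_iff hn0 ⟨p, hp⟩).1 h2
  · rw [choiceSet_eq_twistSet hn0 a hA fun p => by rw [hA p]]
    rfl

/-! ### Counting -/

/-- The count for one pair of blocks: a double edge allows every proper non-empty subset, while a
single edge forces `univ` or `∅` according to its direction. -/
theorem card_filter_nonempty_ne_univ {α : Type*} [Fintype α] [DecidableEq α] [Nonempty α]
    {P Q : Prop} (hPQ : P ∨ Q) [Decidable P] [Decidable Q] :
    (Finset.univ.filter fun s : Finset α =>
      (s.Nonempty ↔ P) ∧ (s ≠ Finset.univ ↔ Q)).card =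
        if P ∧ Q then 2 ^ Fintype.card α - 2 else 1 := by
  have hne : (∅ : Finset α) ≠ Finset.univ := Finset.univ_nonempty.ne_empty.symm
  by_cases hP : P <;> by_cases hQ : Q
  · have : (Finset.univ.filter fun s : Finset α =>
        (s.Nonempty ↔ P) ∧ (s ≠ Finset.univ ↔ Q)) = Finset.univ \ {∅, Finset.univ} := by
      ext s
      simp [hP, hQ, Finset.nonempty_iff_ne_empty]
    rw [this, Finset.card_sdiff_of_subset (Finset.subset_univ _), Finset.card_pair hne,
      Finset.card_univ, Fintype.card_finset, if_pos ⟨hP, hQ⟩]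
  · have : (Finset.univ.filter fun s : Finset α =>
        (s.Nonempty ↔ P) ∧ (s ≠ Finset.univ ↔ Q)) = {Finset.univ} := by
      ext s
      simp only [hP, hQ, iff_true, iff_false, not_not, Finset.mem_filter, Finset.mem_univ, true_and,
        Finset.mem_singleton, ne_eq]
      exact ⟨And.right, fun h => ⟨h ▸ Finset.univ_nonempty, h⟩⟩
    rw [this, if_neg fun h => hQ h.2, Finset.card_singleton]
  · have : (Finset.univ.filter fun s : Finset α =>
        (s.Nonempty ↔ P) ∧ (s ≠ Finset.univ ↔ Q)) = {∅} := by
      ext s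
      simp only [hP, hQ, iff_true, iff_false, Finset.mem_filter, Finset.mem_univ, true_and,
        Finset.mem_singleton, Finset.not_nonempty_iff_eq_empty]
      exact ⟨And.left, fun h => ⟨h, h ▸ hne⟩⟩
    rw [this, if_neg fun h => hP h.1, Finset.card_singleton]
  · exact absurd hPQ (not_or.2 ⟨hP, hQ⟩)

theorem numDoubleEdges_eq_card (G : Digraph (Fin m)) [DecidableRel G.Adj] :
    numDoubleEdges G = (Finset.univ.filter fun p : OrderedPair m =>
      G.Adj p.1.2 p.1.1 ∧ G.Adj p.1.1 p.1.2).card := by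
  rw [← Finset.card_map (Function.Embedding.subtype _), ← Set.ncard_coe_finset, numDoubleEdges]
  congr 1
  ext p
  simp only [Finset.coe_map, Function.Embedding.subtype_apply, Set.mem_image, Finset.coe_filter,
    Finset.mem_univ, true_and, Set.mem_ofPred_eq]
  exact ⟨fun h => ⟨⟨p, h.1⟩, ⟨h.2.2, h.2.1⟩, rfl⟩, fun ⟨q, hq, h⟩ => h ▸ ⟨q.2, hq.2, hq.1⟩⟩

theorem numDoubleEdges_le (G : Digraph (Fin m)) : numDoubleEdges G ≤ m.choose 2 := by
  classical
  rw [numDoubleEdges_eq_card]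
  have hcard : (Finset.powersetCard 2 (Finset.univ : Finset (Fin m))).card = m.choose 2 := by
    rw [Finset.card_powersetCard, Finset.card_univ, Fintype.card_fin]
  rw [← hcard]
  refine Finset.card_le_card_of_injOn (fun p => {p.1.1, p.1.2}) (fun p _ => ?_) ?_
  · exact Finset.mem_powersetCard.2 ⟨Finset.subset_univ _, Finset.card_pair p.2.ne⟩
  · rintro ⟨⟨i, j⟩, hij⟩ - ⟨⟨i', j'⟩, hij'⟩ - h
    dsimp only at h hij hij'
    have h' : s(i, j) = s(i', j') := by
      rw [← Finset.coe_inj] at h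
      simp only [Finset.coe_pair] at h
      rcases Set.pair_eq_pair_iff.1 h with ⟨rfl, rfl⟩ | ⟨rfl, rfl⟩
      · rfl
      · exact Sym2.eq_swap
    rcases Sym2.eq_iff.1 h' with ⟨rfl, rfl⟩ | ⟨rfl, rfl⟩
    · rfl
    · exact absurd hij hij'.asymm

theorem choiceGraph_eq_iff (hn : 0 < n) {a : OrderedPair m → Finset (Equiv.Perm (Fin n))}
    {G : Digraph (Fin m)} (hG : ∀ v, ¬ G.Adj v v) :
    choiceGraph a = G ↔ ∀ p : OrderedPair m,
      ((a p).Nonempty ↔ G.Adj p.1.2 p.1.1) ∧ (a p ≠ Finset.univ ↔ G.Adj p.1.1 p.1.2) := by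
  simp only [← choiceGraph_adj_snd_fst_iff hn, ← choiceGraph_adj_fst_snd_iff hn]
  refine ⟨fun h p => by rw [h]; exact ⟨Iff.rfl, Iff.rfl⟩, fun h => ?_⟩
  ext i j
  rcases lt_trichotomy i j with hij | rfl | hij
  · exact (h ⟨(i, j), hij⟩).2
  · exact iff_of_false ((isCompleteDigraph_choiceGraph hn a).1 i) (hG i)
  · exact (h ⟨(j, i), hij⟩).1

open Classical in
-- Having digraph `G` is an independent condition on each `a p`, so the fibre is a product in which
-- only double edges contribute a factor other than `1`.
theorem card_choiceGraph_eq (hn : 0 < n) {G : Digraph (Fin m)} (hG : IsCompleteDigraph G) :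
    (Finset.univ.filter fun a : OrderedPair m → Finset (Equiv.Perm (Fin n)) =>
      choiceGraph a = G).card = (2 ^ n.factorial - 2) ^ numDoubleEdges G := by
  have : (Finset.univ.filter fun a : OrderedPair m → Finset (Equiv.Perm (Fin n)) =>
      choiceGraph a = G) = Fintype.piFinset fun p : OrderedPair m =>
        Finset.univ.filter fun s : Finset (Equiv.Perm (Fin n)) =>
          (s.Nonempty ↔ G.Adj p.1.2 p.1.1) ∧ (s ≠ Finset.univ ↔ G.Adj p.1.1 p.1.2) := by
    ext a
    simp only [Finset.mem_filter, Finset.mem_univ, true_and, Fintype.mem_piFinset]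
    exact choiceGraph_eq_iff hn hG.1
  rw [this, Fintype.card_piFinset]
  rw [Finset.prod_congr rfl fun p _ => card_filter_nonempty_ne_univ
    (α := Equiv.Perm (Fin n)) (hG.2 p.1.2 p.1.1 p.2.ne')]
  rw [Finset.prod_ite, Finset.prod_const_one, mul_one, Finset.prod_const, numDoubleEdges_eq_card,
    Fintype.card_perm, Fintype.card_fin]

theorem ncard_isStronglyConnected_choiceGraph (hn : 0 < n) :
    {a : OrderedPair m → Finset (Equiv.Perm (Fin n)) |
        IsStronglyConnected (choiceGraph a)}.ncard =
      ∑ k ∈ Finset.range (m.choose 2 + 1), wDouble m k * (2 ^ n.factorial - 2) ^ k := by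
  classical
  let S : Finset (Digraph (Fin m)) :=
    Finset.univ.filter fun G => IsCompleteDigraph G ∧ IsStronglyConnected G
  have h1 : (Finset.univ.filter fun a : OrderedPair m → Finset (Equiv.Perm (Fin n)) =>
      IsStronglyConnected (choiceGraph a)).card =
        ∑ G ∈ S, (2 ^ n.factorial - 2) ^ numDoubleEdges G := by
    rw [Finset.card_eq_sum_card_fiberwise (f := choiceGraph) (t := S)]
    · refine Finset.sum_congr rfl fun G hG => ?_
      rw [← card_choiceGraph_eq hn (Finset.mem_filter.1 hG).2.1, Finset.filter_filter]
      congr 1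
      ext a
      simp only [Finset.mem_filter, Finset.mem_univ, true_and, and_iff_right_iff_imp]
      rintro rfl
      exact (Finset.mem_filter.1 hG).2.2
    · intro a ha
      exact Finset.mem_coe.2 (Finset.mem_filter.2 ⟨Finset.mem_univ _,
        isCompleteDigraph_choiceGraph hn a, (Finset.mem_filter.1 (Finset.mem_coe.1 ha)).2⟩)
  have h2 : ∀ k, wDouble m k = (S.filter fun G => numDoubleEdges G = k).card := fun k => by
    rw [wDouble, ← Set.ncard_coe_finset]
    congr 1
    ext G
    simp [S, and_assoc]
  rw [← Finset.sum_fiberwise_of_maps_to (g := numDoubleEdges)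
    (t := Finset.range (m.choose 2 + 1))
    (fun G _ => Finset.mem_range.2 (Nat.lt_succ_of_le (numDoubleEdges_le G)))] at h1
  have h3 : {a : OrderedPair m → Finset (Equiv.Perm (Fin n)) |
      IsStronglyConnected (choiceGraph a)} = ((Finset.univ.filter fun a :
        OrderedPair m → Finset (Equiv.Perm (Fin n)) =>
          IsStronglyConnected (choiceGraph a) : Finset _) : Set _) := by
    ext a
    simp
  rw [h3, Set.ncard_coe_finset, h1]
  refine Finset.sum_congr rfl fun k _ => ?_
  rw [h2, ← smul_eq_mul, ← Finset.sum_const]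
  exact Finset.sum_congr rfl fun G hG => by rw [(Finset.mem_filter.1 hG).2]

theorem ncard_isStandard (hn : 2 ≤ n) :
    {W : Set (Function.End (Fin m × Fin n)) | IsStandard W}.ncard =
      sigma n ^ m *
        ∑ k ∈ Finset.range (m.choose 2 + 1), wDouble m k * (2 ^ n.factorial - 2) ^ k := by
  have hn0 : 0 < n := by omega
  have h : {W : Set (Function.End (Fin m × Fin n)) | IsStandard W} =
      (fun x : (Fin m → Set (Function.End (Fin n))) ×
          (OrderedPair m → Finset (Equiv.Perm (Fin n))) => standardSet x.1 x.2) ''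
        ((Set.pi Set.univ fun _ => {U | IsMinimalIdempotentGeneratingSet (E n) U}) ×ˢ
          {a | IsStronglyConnected (choiceGraph a)}) := by
    ext W
    constructor
    · rintro ⟨U, a, hU, ha, rfl⟩
      exact ⟨(U, a), ⟨fun i _ => hU i, ha⟩, rfl⟩
    · rintro ⟨⟨U, a⟩, ⟨hU, ha⟩, rfl⟩
      exact ⟨U, a, fun i => hU i trivial, ha, rfl⟩
  rw [h, Set.InjOn.ncard_image, Set.ncard_prod, ncard_isStronglyConnected_choiceGraph hn0]
  · congr 1
    rw [Set.ncard, Set.encard_pi_eq_prod_encard, Finset.prod_const, Finset.card_univ,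
      Fintype.card_fin, ← ENat.coe_toNatHom, map_pow, ← ncard_isMinimalIdempotentGeneratingSet_E hn]
    rfl
  -- The pair is recovered from its standard set: `U i` as the preimage under `inBlock i`, and `a`
  -- from the twists contained in the set.
  · rintro ⟨U, a⟩ ⟨hU, -⟩ ⟨U', a'⟩ ⟨hU', -⟩ heq
    dsimp only at heq
    refine Prod.ext (funext fun i => ?_) (choiceSet_injective hn0 ?_)
    · rw [← inBlock_preimage_standardSet hn (fun i => hU i trivial) a i, heq,
        inBlock_preimage_standardSet hn (fun i => hU' i trivial) a' i]
    · have key : ∀ (U U' : Fin m → Set (Function.End (Fin n)))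
          (a a' : OrderedPair m → Finset (Equiv.Perm (Fin n))),
          standardSet U a = standardSet U' a' → choiceSet a ⊆ choiceSet a' := by
        intro U U' a a' heq t ht
        obtain ⟨i, j, f, hij, rfl⟩ := choiceSet_subset_twists a ht
        rw [← eTwist_mem_standardSet_iff hn0 (U := U') hij, ← heq]
        exact Or.inr ht
      exact Set.Subset.antisymm (key _ _ _ _ heq) (key _ _ _ _ heq.symm)

end Choice

end UniformPartition

theorem theorem4p11 (m n : ℕ) (hm : 2 ≤ m) (hn : 2 ≤ n) :
    -- every idempotent generating set contains one of minimal size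
    (∀ U : Set (Function.End (Fin m × Fin n)),
      UniformPartition.IsIdempotentGeneratingSet (UniformPartition.EXP m n) U →
        ∃ W ⊆ U, UniformPartition.IsMinimalIdempotentGeneratingSet
          (UniformPartition.EXP m n) W) ∧
    -- minimality by size coincides with minimality by inclusion
    (∀ W : Set (Function.End (Fin m × Fin n)),
      UniformPartition.IsMinimalIdempotentGeneratingSet (UniformPartition.EXP m n) W ↔
        Minimal (UniformPartition.IsIdempotentGeneratingSet (UniformPartition.EXP m n)) W) ∧
    -- the form of the minimal idempotent generating sets
    (∀ W : Set (Function.End (Fin m × Fin n)),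
      UniformPartition.IsMinimalIdempotentGeneratingSet (UniformPartition.EXP m n) W →
        UniformPartition.HasStandardForm W) ∧
    -- the number of minimal idempotent generating sets
    {W : Set (Function.End (Fin m × Fin n)) |
        UniformPartition.IsMinimalIdempotentGeneratingSet (UniformPartition.EXP m n) W}.ncard =
      UniformPartition.sigma n ^ m *
        ∑ k ∈ Finset.range (m.choose 2 + 1),
          UniformPartition.wDouble m k * (2 ^ n.factorial - 2) ^ k := by
  have hiff := UniformPartition.isMinimal_iff_isStandard (m := m) hn
  refine ⟨fun U hU => ?_, fun W => (hiff W).1.trans (hiff W).2.symm,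
    fun W hW => UniformPartition.hasStandardForm_of_isStandard hn ((hiff W).1.1 hW), ?_⟩
  · obtain ⟨W, hWU, hW⟩ := UniformPartition.exists_isStandard_subset hn hU
    exact ⟨W, hWU, (hiff W).1.2 hW⟩
  · rw [← UniformPartition.ncard_isStandard hn]
    congr 1
    ext W
    exact (hiff W).1
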